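/- Let $\Phi=\{\Phi(t)\}_{t\in\mathbb{R}}$ be a real-valued, jointly measurable, mean-square continuous, stationary Gaussian process whose covariance function has an (integrable) spectral density $p:\mathbb{R}\to(0,\infty)$, i.e. $\mathrm{Cov}(\Phi(t),\Phi(0))=\int_{\mathbb{R}}e^{it\lambda}p(\lambda)\,d\lambda$ for all $t\in\mathbb{R}$. Let $\psi\in L^1(\mathbb{R})\cap L^2(\mathbb{R})$ be an analytic mother wavelet: $\widehat\psi(\omega)=\int_{\mathbb{R}}e^{-it\omega}\psi(t)\,dt$ vanishes for all $\omega\le 0$. Assume that $\widehat\psi$ is differentiable on $(0,\infty)$ with $$\sup_{\lambda>1}|\lambda\widehat\psi(\lambda)|<\infty,\qquad \sup_{\lambda>0}|D\widehat\psi(\lambda)|<\infty,\qquad \sup_{\lambda>0}|\lambda D\widehat\psi(\lambda)|<\infty .$$ Let $W_\Phi$ be the analytic wavelet transform of $\Phi$, $$W_\Phi(t,s)=\int_{\mathbb{R}}\Phi(\tau)\,\frac1s\,\overline{\psi\Big(\frac{\tau-t}{s}\Big)}\,d\tau,\qquad t\in\mathbb{R},\ s>0 .$$ Then, almost surely, this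 integral converges absolutely for all $t\in\mathbb{R}$ and $s>0$, and the following hold. (a) If there are constants $\gamma\in(0,2)$ and $C_1>0$ with $p(\lambda)\le C_1|\lambda|^{-(1+\gamma)}$ for all $\lambda\ne0$, then $$\mathbb{P}\Big(\lim_{s\to0+}W_\Phi(t,s)=0\ \text{for all } t\in\mathbb{R}\Big)=1 .$$ (b) Suppose that one of the following two conditions holds: (b1) (long-range dependence) there are $H\in(0,1)$ and a locally bounded function $L:(0,\infty)\to(0,\infty)$, slowly varying at infinity (that is, $L(cr)/L(r)\to1$ as $r\to\infty$ for every $c>0$), such that $p(\lambda)=L(|\lambda|^{-1})|\lambda|^{H-1}$ for all $\lambda\ne0$ in some neighbourhood of the origin; (b2) (short-range dependence) $p$ is bounded and is continuous at the origin. Then $$\mathbb{P}\Big(\lim_{s\to\infty}W_\Phi(t,s)=0\ \text{for all } t\in\mathbb{R}\Big)=1 .$$ -/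

import Mathlib

open MeasureTheory ProbabilityTheory Filter Set
open scoped Topology

noncomputable section

namespace WaveletNoise

/-- The Fourier transform with the convention `ψ̂(ω) = ∫ e^{-i t ω} ψ(t) dt`. -/
def fourierHat (ψ : ℝ → ℂ) (ω : ℝ) : ℂ :=
  ∫ t : ℝ, Complex.exp (-(Complex.I * t * ω)) * ψ t

/-- An analytic mother wavelet: `ψ ∈ L¹(ℝ) ∩ L²(ℝ)` and `ψ̂(ω) = 0` for `ω ≤ 0`. -/
structure IsAnalyticWavelet (ψ : ℝ → ℂ) : Prop where
  integrable : Integrable ψ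
  memLp_two : MemLp ψ 2
  analytic : ∀ ω : ℝ, ω ≤ 0 → fourierHat ψ ω = 0

/-- The integrand of the analytic wavelet transform at time `t` and scale `s`:
`τ ↦ f(τ) s⁻¹ conj ψ((τ - t) / s)`. -/
def awtIntegrand (ψ : ℝ → ℂ) (f : ℝ → ℝ) (t s : ℝ) (τ : ℝ) : ℂ :=
  (f τ : ℂ) * ((1 / s : ℝ) : ℂ) * (starRingEnd ℂ) (ψ ((τ - t) / s))

/-- The analytic wavelet transform `W_f(t,s) = ∫ f(τ) s⁻¹ conj ψ((τ - t) / s) dτ`. -/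
def awt (ψ : ℝ → ℂ) (f : ℝ → ℝ) (t s : ℝ) : ℂ :=
  ∫ τ : ℝ, awtIntegrand ψ f t s τ

/-- The regularity conditions on `ψ̂`: differentiability on `(0,∞)`, and
`sup_{λ>1} |λ ψ̂(λ)| < ∞`, `sup_{λ>0} |Dψ̂(λ)| < ∞`, `sup_{λ>0} |λ Dψ̂(λ)| < ∞`. -/
structure WaveletRegularity (ψ : ℝ → ℂ) : Prop where
  differentiable : DifferentiableOn ℝ (fourierHat ψ) (Ioi 0)
  d01 : ∃ C : ℝ, ∀ x : ℝ, 1 < x → ‖(x : ℂ) * fourierHat ψ x‖ ≤ C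
  d10 : ∃ C : ℝ, ∀ x : ℝ, 0 < x → ‖deriv (fourierHat ψ) x‖ ≤ C
  d11 : ∃ C : ℝ, ∀ x : ℝ, 0 < x → ‖(x : ℂ) * deriv (fourierHat ψ) x‖ ≤ C

/-- Strict stationarity: the finite-dimensional distributions are invariant under time shifts. -/
def IsStationaryProcess {Ω : Type*} [MeasurableSpace Ω] (P : Measure Ω) (Φ : ℝ → Ω → ℝ) : Prop :=
  ∀ (h : ℝ) (I : Finset ℝ),
    IdentDistrib (fun ω => fun t : I => Φ ((t : ℝ) + h) ω) (fun ω => fun t : I => Φ (t : ℝ) ω) P P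

/-- Mean-square continuity: `E|Φ(t') - Φ(t)|² → 0` as `t' → t`. -/
def IsMeanSquareContinuous {Ω : Type*} [MeasurableSpace Ω] (P : Measure Ω)
    (Φ : ℝ → Ω → ℝ) : Prop :=
  ∀ t : ℝ, Tendsto (fun t' : ℝ => eLpNorm (fun ω => Φ t' ω - Φ t ω) 2 P) (𝓝 t) (𝓝 0)

/-- `p : ℝ → (0,∞)` is a spectral density function of the covariance of `Φ`:
`Cov(Φ(t), Φ(0)) = ∫ e^{i t λ} p(λ) dλ`. -/
structure IsSpectralDensity {Ω : Type*} [MeasurableSpace Ω] (P : Measure Ω)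
    (Φ : ℝ → Ω → ℝ) (p : ℝ → ℝ) : Prop where
  pos : ∀ x : ℝ, 0 < p x
  integrable : Integrable p
  cov_eq : ∀ t : ℝ, ((covariance (Φ t) (Φ 0) P : ℝ) : ℂ) =
    ∫ x : ℝ, Complex.exp (Complex.I * t * x) * (p x : ℂ)

/-- The noise: a (jointly measurable) mean-square continuous, stationary, real-valued Gaussian
process whose covariance has the spectral density `p`. -/
structure IsGaussianNoise {Ω : Type*} [MeasurableSpace Ω] (P : Measure Ω)
    (Φ : ℝ → Ω → ℝ) (p : ℝ → ℝ) : Prop where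
  measurable : Measurable (Function.uncurry Φ)
  gaussian : IsGaussianProcess Φ P
  stationary : IsStationaryProcess P Φ
  meanSquareContinuous : IsMeanSquareContinuous P Φ
  spectralDensity : IsSpectralDensity P Φ p

/-- Decay of the spectral density: `p(λ) ≤ C₁ |λ|^{-(1+γ)}` for all `λ ≠ 0`, for some
`γ ∈ (0,2)` and `C₁ > 0`. -/
def SpectralDecay (p : ℝ → ℝ) : Prop :=
  ∃ γ C₁ : ℝ, 0 < γ ∧ γ < 2 ∧ 0 < C₁ ∧ ∀ x : ℝ, x ≠ 0 → p x ≤ C₁ * |x| ^ (-(1 + γ))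

/-- `L : (0,∞) → (0,∞)` is locally bounded and slowly varying at infinity
(only the values of `L` on `(0,∞)` matter). -/
structure IsSlowlyVarying (L : ℝ → ℝ) : Prop where
  pos : ∀ r : ℝ, 0 < r → 0 < L r
  locallyBounded : ∀ K : Set ℝ, K ⊆ Ioi 0 → IsCompact K → ∃ M : ℝ, ∀ r ∈ K, L r ≤ M
  slowly : ∀ c : ℝ, 0 < c → Tendsto (fun r : ℝ => L (c * r) / L r) atTop (𝓝 1)

/-- Long-range dependence: `p(λ) = L(|λ|⁻¹) |λ|^{H-1}` near the origin (off the origin itself). -/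
def LongRangeDependence (p : ℝ → ℝ) : Prop :=
  ∃ (H : ℝ) (L : ℝ → ℝ), 0 < H ∧ H < 1 ∧ IsSlowlyVarying L ∧
    ∀ᶠ x in 𝓝[≠] (0 : ℝ), p x = L (|x|⁻¹) * |x| ^ (H - 1)

/-- Short-range dependence: `p` is bounded and continuous at the origin. -/
def ShortRangeDependence (p : ℝ → ℝ) : Prop :=
  (∃ M : ℝ, ∀ x : ℝ, p x ≤ M) ∧ ContinuousAt p 0

end WaveletNoise

end

/-!
Centre the process. Every value of its wavelet transform at scale `s` is an `L²` limit of linear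
combinations of jointly Gaussian variables, so all its moments are controlled by its variance,
which is `∫ |ψ̂(s λ)|² p(λ) dλ`. As `ψ̂` vanishes at the origin, is Lipschitz and decays like
`1 / λ`, cutting the spectrum at `|λ| = s ^ (-1/2)` shows that this variance decays like a power of
`s` as `s → 0` or `s → ∞`, provided `p` has little mass at high, respectively low, frequencies.

Along the paths, the decay of `ψ̂'` puts `(1 + |τ|) ψ(τ)` in `L²`. A weighted Cauchy–Schwarz
inequality then bounds the increments of the transform by a Hölder modulus in `(t, s)` whose
constant grows polynomially with the range of `(t, s)`. High moments and Borel–Cantelli on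
polynomially fine grids therefore give almost sure convergence for all `t` at once. The mean of the
process plays no role, because `∫ ψ = 0`.
-/

namespace WaveletNoise

open scoped ENNReal NNReal FourierTransform

section LintegralNormalForms

theorem lintegral_enorm_pow {α ε : Type*} [MeasurableSpace α] [ENorm ε] {μ : Measure α}
    (f : α → ε) {n : ℕ} (hn : n ≠ 0) : ∫⁻ x, ‖f x‖ₑ ^ n ∂μ = eLpNorm f n μ ^ n := by
  have h := eLpNorm_nnreal_pow_eq_lintegral (μ := μ) (f := f) (p := n) (by exact_mod_cast hn)
  simpa using h.symm

theorem lintegral_enorm_sq {α ε : Type*} [MeasurableSpace α] [ENorm ε] {μ : Measure α}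
    (f : α → ε) : ∫⁻ x, ‖f x‖ₑ ^ 2 ∂μ = eLpNorm f 2 μ ^ 2 := by
  exact_mod_cast lintegral_enorm_pow f two_ne_zero

theorem lintegral_comp_mul_left (f : ℝ → ℝ≥0∞) {a : ℝ} (ha : a ≠ 0) :
    ∫⁻ x, f (a * x) = ENNReal.ofReal |a⁻¹| * ∫⁻ x, f x := by
  have h := lintegral_map_equiv (μ := volume) f (Homeomorph.mulLeft₀ a ha).toMeasurableEquiv
  rw [show ⇑(Homeomorph.mulLeft₀ a ha).toMeasurableEquiv = (a * ·) from rfl,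
    Real.map_volume_mul_left ha, lintegral_smul_measure] at h
  exact h.symm

theorem lintegral_comp_sub_div (f : ℝ → ℝ≥0∞) (t : ℝ) {s : ℝ} (hs : 0 < s) :
    ∫⁻ x, f ((x - t) / s) = ENNReal.ofReal s * ∫⁻ x, f x := by
  rw [lintegral_sub_right_eq_self (fun x => f (x / s)) t]
  simp_rw [div_eq_inv_mul]
  rw [lintegral_comp_mul_left f (inv_ne_zero hs.ne'), inv_inv, abs_of_pos hs]

end LintegralNormalForms

section Plancherel

variable {V E : Type*} [NormedAddCommGroup V] [InnerProductSpace ℝ V] [FiniteDimensional ℝ V]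
  [MeasurableSpace V] [BorelSpace V] [NormedAddCommGroup E] [InnerProductSpace ℂ E]
  [CompleteSpace E]

open SchwartzMap in
theorem coeFn_fourier_toLp {f : V → E} (hf₁ : Integrable f) (hf₂ : MemLp f 2) :
    (𝓕 (hf₂.toLp f) : Lp E 2 (volume : Measure V)) =ᵐ[volume] 𝓕 f := by
  have hcont : Continuous (𝓕 f) := VectorFourier.fourierIntegral_continuous
    Real.continuous_fourierChar (by exact continuous_inner) hf₁
  refine ae_eq_of_integral_contDiff_smul_eq ((Lp.memLp _).locallyIntegrable (by norm_num))
    hcont.locallyIntegrable fun g hg hg_supp => ?_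
  have hsupp : HasCompactSupport (fun x => (g x : ℂ)) :=
    hg_supp.comp_left (g := fun x : ℝ => (x : ℂ)) (by simp)
  have hdiff : ContDiff ℝ (⊤ : ℕ∞) (fun x => (g x : ℂ)) := Complex.ofRealCLM.contDiff.comp hg
  set G : 𝓢(V, ℂ) := hsupp.toSchwartzMap hdiff
  have hG (x : V) (y : E) : g x • y = G x • y := Complex.coe_smul (g x) y ▸ rfl
  simp only [hG]
  calc ∫ x, G x • (𝓕 (hf₂.toLp f) : Lp E 2 (volume : Measure V)) x
      = ∫ x, (𝓕 G) x • (hf₂.toLp f) x := by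
        rw [← Lp.toTemperedDistribution_apply, ← Lp.fourier_toTemperedDistribution_eq,
          TemperedDistribution.fourier_apply, Lp.toTemperedDistribution_apply]
    _ = ∫ x, (𝓕 G) x • f x := by
        refine integral_congr_ae ?_
        filter_upwards [hf₂.coeFn_toLp] with x hx
        rw [hx]
    _ = ∫ x, G x • 𝓕 f x := by
        rw [SchwartzMap.fourier_coe]
        simpa using! VectorFourier.integral_fourierIntegral_smul_eq_flip (L := innerₗ V)
          Real.continuous_fourierChar continuous_inner G.integrable hf₁

theorem eLpNorm_fourier {f : V → E} (hf₁ : Integrable f) (hf₂ : MemLp f 2) :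
    eLpNorm (𝓕 f) 2 volume = eLpNorm f 2 volume := by
  rw [← eLpNorm_congr_ae (coeFn_fourier_toLp hf₁ hf₂), ← Lp.enorm_def, ← ofReal_norm,
    Lp.norm_fourier_eq, ofReal_norm, Lp.enorm_toLp]

end Plancherel

section FourierHat

variable {f : ℝ → ℂ}

theorem fourierHat_eq_fourier (f : ℝ → ℂ) (x : ℝ) :
    fourierHat f x = 𝓕 f ((2 * Real.pi)⁻¹ * x) := by
  rw [Real.fourier_eq', fourierHat]
  congr 1 with t
  rw [smul_eq_mul]
  congr 2
  have : (Real.pi : ℂ) ≠ 0 := by exact_mod_cast Real.pi_ne_zero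
  simp only [neg_mul, mul_inv_rev, RCLike.inner_apply, Real.ringHom_apply, Complex.ofReal_neg,
    Complex.ofReal_mul, Complex.ofReal_ofNat, Complex.ofReal_inv, neg_inj]
  field_simp

theorem continuous_fourierHat (hf : Integrable f) : Continuous (fourierHat f) := by
  have hcont : Continuous (𝓕 f) := VectorFourier.fourierIntegral_continuous
    Real.continuous_fourierChar (by exact continuous_inner) hf
  rw [funext (fourierHat_eq_fourier f)]
  fun_prop

theorem norm_exp_neg_I_mul (t x : ℝ) : ‖Complex.exp (-(Complex.I * t * x))‖ = 1 := by
  rw [show -(Complex.I * t * x) = ((-(t * x) : ℝ) : ℂ) * Complex.I by push_cast; ring,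
    Complex.norm_exp_ofReal_mul_I]

theorem integrable_exp_neg_I_mul (hf : Integrable f) (x : ℝ) :
    Integrable fun t : ℝ => Complex.exp (-(Complex.I * t * x)) * f t :=
  hf.bdd_mul (c := 1) (by fun_prop) (ae_of_all _ fun t => (norm_exp_neg_I_mul t x).le)

theorem norm_fourierHat_le (f : ℝ → ℂ) (x : ℝ) : ‖fourierHat f x‖ ≤ ∫ t, ‖f t‖ := by
  refine (norm_integral_le_integral_norm _).trans (le_of_eq ?_)
  simp only [norm_mul, norm_exp_neg_I_mul, one_mul]

theorem fourierHat_const_mul (c : ℂ) (f : ℝ → ℂ) (x : ℝ) :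
    fourierHat (fun t => c * f t) x = c * fourierHat f x := by
  simp only [fourierHat, mul_left_comm _ c, integral_const_mul]

theorem fourierHat_sub {g : ℝ → ℂ} (hf : Integrable f) (hg : Integrable g) (x : ℝ) :
    fourierHat (fun t => f t - g t) x = fourierHat f x - fourierHat g x := by
  simp only [fourierHat, mul_sub]
  exact integral_sub (integrable_exp_neg_I_mul hf x) (integrable_exp_neg_I_mul hg x)

theorem fourierHat_exp_mul (f : ℝ → ℂ) (h x : ℝ) :
    fourierHat (fun t => Complex.exp (-(Complex.I * t * h)) * f t) x = fourierHat f (x + h) := by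
  simp only [fourierHat, ← mul_assoc, ← Complex.exp_add]
  congr 1 with t
  push_cast
  ring_nf

theorem lintegral_fourierHat_sq (hf₁ : Integrable f) (hf₂ : MemLp f 2) :
    ∫⁻ x, ‖fourierHat f x‖ₑ ^ 2 = ENNReal.ofReal (2 * Real.pi) * ∫⁻ x, ‖f x‖ₑ ^ 2 := by
  simp_rw [fourierHat_eq_fourier]
  rw [lintegral_comp_mul_left (fun x => ‖𝓕 f x‖ₑ ^ 2) (by positivity), inv_inv,
    abs_of_pos (by positivity), lintegral_enorm_sq, eLpNorm_fourier hf₁ hf₂, lintegral_enorm_sq]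

theorem lintegral_sq_le_lintegral_fourierHat_sq (hf₁ : Integrable f) (hf₂ : MemLp f 2) :
    ∫⁻ x, ‖f x‖ₑ ^ 2 ≤ ∫⁻ x, ‖fourierHat f x‖ₑ ^ 2 := by
  rw [lintegral_fourierHat_sq hf₁ hf₂]
  refine le_mul_of_one_le_left zero_le (ENNReal.one_le_ofReal.2 ?_)
  linarith [Real.pi_gt_three]

end FourierHat

section FirstMoment

variable {f : ℝ → ℂ}

theorem fourierHat_slope (hf : Integrable f) (h x : ℝ) :
    fourierHat (fun u => (h : ℂ)⁻¹ * (Complex.exp (-(Complex.I * u * h)) * f u - f u)) x =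
      (fourierHat f (x + h) - fourierHat f x) / h := by
  rw [fourierHat_const_mul, fourierHat_sub (integrable_exp_neg_I_mul hf h) hf, fourierHat_exp_mul,
    div_eq_inv_mul]

theorem tendsto_inv_mul_exp_neg_I_mul_sub (z : ℂ) (u : ℝ) :
    Tendsto (fun h : ℝ => (h : ℂ)⁻¹ * (Complex.exp (-(Complex.I * u * h)) * z - z)) (𝓝[>] 0)
      (𝓝 (-(Complex.I * u) * z)) := by
  have hlin : HasDerivAt (fun x : ℝ => -(Complex.I * u * (x : ℂ))) (-(Complex.I * u)) 0 := by
    simpa using (((hasDerivAt_id (0 : ℝ)).ofReal_comp).const_mul (Complex.I * u)).fun_neg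
  have hexp : HasDerivAt (fun x : ℝ => Complex.exp (-(Complex.I * u * x)) * z)
      (-(Complex.I * u) * z) 0 := by
    simpa using hlin.cexp.mul_const z
  simpa using hexp.tendsto_slope_zero_right

theorem memLp_slope (hf : MemLp f 2) (h : ℝ) :
    MemLp (fun u : ℝ => (h : ℂ)⁻¹ * (Complex.exp (-(Complex.I * u * h)) * f u - f u)) 2 := by
  have hexp : MemLp (fun u : ℝ => Complex.exp (-(Complex.I * u * h)) * f u) 2 :=
    hf.of_le (AEStronglyMeasurable.mul (by fun_prop) hf.aestronglyMeasurable)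
      (ae_of_all _ fun u => by rw [norm_mul, norm_exp_neg_I_mul, one_mul])
  exact (hexp.sub hf).const_mul _

/-- Multiplication by `u` is a limit of difference quotients on the Fourier side, so by Plancherel
and Fatou it suffices to bound these in `L²`. -/
theorem lintegral_mul_sq_le_of_slope_fourierHat_le (hf₁ : Integrable f) (hf₂ : MemLp f 2)
    {B : ℝ≥0∞} (hB : ∀ h : ℝ, 0 < h → h ≤ 1 →
      ∫⁻ x, ‖(fourierHat f (x + h) - fourierHat f x) / h‖ₑ ^ 2 ≤ B) :
    ∫⁻ u : ℝ, ‖(u : ℂ) * f u‖ₑ ^ 2 ≤ B := by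
  set q : ℝ → ℝ → ℂ := fun h u => (h : ℂ)⁻¹ * (Complex.exp (-(Complex.I * u * h)) * f u - f u)
  have hq (h : ℝ) : Integrable (q h) :=
    ((integrable_exp_neg_I_mul hf₁ h).sub hf₁).const_mul _
  have hlim (u : ℝ) : Tendsto (fun h => ‖q h u‖ₑ ^ 2) (𝓝[>] 0) (𝓝 (‖(u : ℂ) * f u‖ₑ ^ 2)) := by
    have hnorm : ‖-(Complex.I * u) * f u‖ₑ = ‖(u : ℂ) * f u‖ₑ := by
      rw [enorm_eq_iff_norm_eq]
      simp
    rw [← hnorm]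
    exact ((ENNReal.continuous_pow 2).tendsto _).comp
      (tendsto_inv_mul_exp_neg_I_mul_sub (f u) u).enorm
  calc ∫⁻ u : ℝ, ‖(u : ℂ) * f u‖ₑ ^ 2 = ∫⁻ u : ℝ, liminf (fun h => ‖q h u‖ₑ ^ 2) (𝓝[>] 0) :=
        lintegral_congr fun u => (hlim u).liminf_eq.symm
    _ ≤ liminf (fun h => ∫⁻ u, ‖q h u‖ₑ ^ 2) (𝓝[>] 0) :=
        lintegral_liminf_le' fun h => (hq h).aestronglyMeasurable.enorm.pow_const 2
    _ ≤ liminf (fun _ : ℝ => B) (𝓝[>] 0) := by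
        refine liminf_le_liminf ?_
        filter_upwards [Ioc_mem_nhdsGT one_pos] with h hh
        refine (lintegral_sq_le_lintegral_fourierHat_sq (hq h) (memLp_slope hf₂ h)).trans ?_
        simp only [q, fourierHat_slope hf₁]
        exact hB h hh.1 hh.2
    _ = B := liminf_const B

end FirstMoment

section HalfLine

variable {E : Type*} [NormedAddCommGroup E] [NormedSpace ℝ E] {f : ℝ → E}

theorem norm_sub_le_mul_div_of_norm_smul_deriv_le (hf : DifferentiableOn ℝ f (Ioi 0)) {C : ℝ}
    (hC : ∀ x, 0 < x → ‖x • deriv f x‖ ≤ C) {x y : ℝ} (hx : 0 < x) (hxy : x ≤ y) :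
    ‖f y - f x‖ ≤ C * (y - x) / x := by
  have hderiv (z : ℝ) (hz : z ∈ Ici x) : ‖deriv f z‖ ≤ C / x := by
    have hz0 : 0 < z := hx.trans_le hz
    have h := hC z hz0
    rw [norm_smul, Real.norm_of_nonneg hz0.le] at h
    rw [le_div_iff₀ hx, mul_comm]
    exact (mul_le_mul_of_nonneg_right hz (norm_nonneg _)).trans h
  have h := (convex_Ici x).norm_image_sub_le_of_norm_deriv_le
    (fun z hz => hf.differentiableAt (Ioi_mem_nhds (hx.trans_le hz))) hderiv self_mem_Ici hxy
  rwa [Real.norm_of_nonneg (sub_nonneg.2 hxy), div_mul_eq_mul_div] at h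

theorem lipschitzWith_of_nnnorm_deriv_le_of_Iic_eq_zero (hcont : Continuous f)
    (hzero : ∀ x ≤ 0, f x = 0) (hf : DifferentiableOn ℝ f (Ioi 0)) {K : ℝ≥0}
    (hK : ∀ x, 0 < x → ‖deriv f x‖₊ ≤ K) : LipschitzWith K f := by
  have hIoi : LipschitzOnWith K f (Ioi 0) :=
    (convex_Ioi 0).lipschitzOnWith_of_nnnorm_deriv_le
      (fun x hx => hf.differentiableAt (Ioi_mem_nhds hx)) hK
  have hIci : LipschitzOnWith K f (Ici 0) :=
    closure_Ioi (0 : ℝ) ▸ hIoi.closure hcont.continuousOn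
  have hmax (x : ℝ) : f x = f (max x 0) := by
    rcases le_total x 0 with hx | hx
    · rw [max_eq_right hx, hzero x hx, hzero 0 le_rfl]
    · rw [max_eq_left hx]
  refine LipschitzWith.of_dist_le_mul fun x y => ?_
  rw [hmax x, hmax y]
  refine (hIci.dist_le_mul _ (le_max_right x 0) _ (le_max_right y 0)).trans ?_
  gcongr
  exact abs_max_sub_max_le_abs x y 0

theorem norm_le_div_one_add_abs (hzero : ∀ x ≤ 0, f x = 0) {A C : ℝ} (hA : ∀ x, ‖f x‖ ≤ A)
    (hC : ∀ x, 1 < x → ‖x • f x‖ ≤ C) (x : ℝ) : ‖f x‖ ≤ (2 * A + |C|) / (1 + |x|) := by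
  have hA0 : 0 ≤ A := (norm_nonneg _).trans (hA 0)
  rw [le_div_iff₀ (by positivity)]
  rcases le_or_gt x 0 with hx0 | hx0
  · rw [hzero x hx0, norm_zero, zero_mul]
    positivity
  rw [abs_of_pos hx0]
  rcases le_or_gt x 1 with hx1 | hx1
  · calc ‖f x‖ * (1 + x) ≤ A * (1 + 1) := by gcongr; exact hA x
      _ ≤ 2 * A + |C| := by linarith [abs_nonneg C]
  · have h := hC x hx1
    rw [norm_smul, Real.norm_of_nonneg hx0.le] at h
    linarith [hA x, le_abs_self C]

end HalfLine

/-- An analytic wavelet with quantitative control of `ψ̂`: decay of order `1 / |x|` at infinity, a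
global Lipschitz bound, and a Lipschitz bound of order `1 / x` on `[x, ∞)`. A single constant `C`
serves in the three estimates. -/
structure IsRegularWavelet (ψ : ℝ → ℂ) (C : ℝ) : Prop extends IsAnalyticWavelet ψ where
  decay : ∀ x, ‖fourierHat ψ x‖ ≤ C / (1 + |x|)
  lipschitz : ∀ x y, ‖fourierHat ψ y - fourierHat ψ x‖ ≤ C * |y - x|
  logLipschitz : ∀ x y, 0 < x → x ≤ y → ‖fourierHat ψ y - fourierHat ψ x‖ ≤ C * (y - x) / x

theorem IsAnalyticWavelet.exists_isRegularWavelet {ψ : ℝ → ℂ} (hψ : IsAnalyticWavelet ψ)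
    (hreg : WaveletRegularity ψ) : ∃ C, IsRegularWavelet ψ C := by
  obtain ⟨C₀, h₀⟩ := hreg.d01
  obtain ⟨C₁, h₁⟩ := hreg.d10
  obtain ⟨C₂, h₂⟩ := hreg.d11
  have hdecay := norm_le_div_one_add_abs hψ.analytic (norm_fourierHat_le ψ) h₀
  have hlip : LipschitzWith C₁.toNNReal (fourierHat ψ) :=
    lipschitzWith_of_nnnorm_deriv_le_of_Iic_eq_zero (continuous_fourierHat hψ.integrable)
      hψ.analytic hreg.differentiable fun x hx => NNReal.le_toNNReal_of_coe_le (h₁ x hx)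
  have hlog (x y : ℝ) (hx : 0 < x) (hxy : x ≤ y) :=
    norm_sub_le_mul_div_of_norm_smul_deriv_le hreg.differentiable h₂ hx hxy
  set C := max (2 * (∫ t, ‖ψ t‖) + |C₀|) (max (C₁.toNNReal : ℝ) C₂)
  have hC₁ : (C₁.toNNReal : ℝ) ≤ C := (le_max_left _ _).trans (le_max_right _ _)
  have hC₂ : C₂ ≤ C := (le_max_right _ _).trans (le_max_right _ _)
  refine ⟨C, hψ, fun x => (hdecay x).trans ?_, fun x y => ?_,
    fun x y hx hxy => (hlog x y hx hxy).trans ?_⟩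
  · gcongr
    exact le_max_left _ _
  · rw [← dist_eq_norm, ← Real.dist_eq]
    exact (hlip.dist_le_mul y x).trans (by gcongr)
  · have := sub_nonneg.2 hxy
    gcongr

namespace IsRegularWavelet

variable {ψ : ℝ → ℂ} {C : ℝ}

theorem const_nonneg (hψ : IsRegularWavelet ψ C) : 0 ≤ C := by
  simpa using (norm_nonneg _).trans (hψ.decay 0)

theorem norm_fourierHat_le_const (hψ : IsRegularWavelet ψ C) (x : ℝ) : ‖fourierHat ψ x‖ ≤ C :=
  (hψ.decay x).trans (div_le_self hψ.const_nonneg (by linarith [abs_nonneg x]))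

theorem norm_fourierHat_le_const_mul_abs (hψ : IsRegularWavelet ψ C) (x : ℝ) :
    ‖fourierHat ψ x‖ ≤ C * |x| := by
  simpa [hψ.analytic 0 le_rfl] using hψ.lipschitz 0 x

theorem norm_slope_le (hψ : IsRegularWavelet ψ C) {h : ℝ} (h0 : 0 < h) (h1 : h ≤ 1) (x : ℝ) :
    ‖(fourierHat ψ (x + h) - fourierHat ψ x) / h‖ ≤ 2 * C / (1 + |x|) := by
  have hC := hψ.const_nonneg
  rw [norm_div, Complex.norm_real, Real.norm_of_nonneg h0.le, div_le_iff₀ h0]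
  rcases le_or_gt |x| 1 with hx | hx
  · refine (hψ.lipschitz x (x + h)).trans ?_
    rw [add_sub_cancel_left, abs_of_pos h0]
    gcongr
    rw [le_div_iff₀ (by positivity)]
    nlinarith
  rcases lt_abs.1 hx with hx | hx
  · have hx0 : 0 < x := by linarith
    refine (hψ.logLipschitz x (x + h) hx0 (by linarith)).trans ?_
    rw [add_sub_cancel_left, abs_of_pos hx0, div_mul_eq_mul_div,
      div_le_div_iff₀ hx0 (by linarith)]
    have : 0 ≤ C * h := by positivity
    nlinarith
  · rw [hψ.analytic _ (by linarith), hψ.analytic _ (by linarith), sub_self, norm_zero]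
    positivity

end IsRegularWavelet

theorem lintegral_one_add_abs_rpow_lt_top {r : ℝ} (hr : 1 < r) :
    ∫⁻ x : ℝ, ENNReal.ofReal ((1 + |x|) ^ (-r)) < ∞ := by
  simpa using (integrable_one_add_norm (E := ℝ) (μ := volume) (r := r)
    (by simpa using hr)).lintegral_lt_top

theorem IsRegularWavelet.lintegral_mul_sq_lt_top {ψ : ℝ → ℂ} {C : ℝ}
    (hψ : IsRegularWavelet ψ C) : ∫⁻ u : ℝ, ‖(u : ℂ) * ψ u‖ₑ ^ 2 < ∞ := by
  have := hψ.const_nonneg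
  have hslope (h : ℝ) (h0 : 0 < h) (h1 : h ≤ 1) :
      ∫⁻ x, ‖(fourierHat ψ (x + h) - fourierHat ψ x) / h‖ₑ ^ 2 ≤
        ∫⁻ x : ℝ, ENNReal.ofReal ((2 * C) ^ 2) * ENNReal.ofReal ((1 + |x|) ^ (-2 : ℝ)) := by
    refine lintegral_mono fun x => ?_
    rw [← ofReal_norm, ← ENNReal.ofReal_pow (norm_nonneg _), ← ENNReal.ofReal_mul (by positivity)]
    refine ENNReal.ofReal_le_ofReal ?_
    calc _ ≤ (2 * C / (1 + |x|)) ^ 2 := by gcongr; exact hψ.norm_slope_le h0 h1 x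
      _ = (2 * C) ^ 2 * (1 + |x|) ^ (-2 : ℝ) := by
        rw [Real.rpow_neg (by positivity), div_pow, div_eq_mul_inv]
        norm_cast
  refine (lintegral_mul_sq_le_of_slope_fourierHat_le hψ.integrable hψ.memLp_two hslope).trans_lt ?_
  rw [lintegral_const_mul' _ _ ENNReal.ofReal_ne_top]
  exact ENNReal.mul_lt_top ENNReal.ofReal_lt_top (lintegral_one_add_abs_rpow_lt_top (by norm_num))

section Atoms

variable {ψ : ℝ → ℂ} {C : ℝ} {a b : ℝ × ℝ}

/-- The wavelet `ψ` translated to the time `a.1` and dilated, with `L¹` normalisation, to the scale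
`a.2`. -/
noncomputable def waveletAtom (ψ : ℝ → ℂ) (a : ℝ × ℝ) (τ : ℝ) : ℂ :=
  (a.2 : ℂ)⁻¹ * ψ ((τ - a.1) / a.2)

theorem awtIntegrand_eq_mul_conj_waveletAtom (ψ : ℝ → ℂ) (f : ℝ → ℝ) (t s τ : ℝ) :
    awtIntegrand ψ f t s τ = (f τ : ℂ) * (starRingEnd ℂ) (waveletAtom ψ (t, s) τ) := by
  simp [awtIntegrand, waveletAtom, mul_assoc]

theorem integrable_waveletAtom (hψ : Integrable ψ) (ha : 0 < a.2) :
    Integrable (waveletAtom ψ a) :=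
  ((hψ.comp_div ha.ne').comp_sub_right a.1).const_mul _

theorem lintegral_mul_waveletAtom_sq (ψ : ℝ → ℂ) (ha : 0 < a.2) (g : ℝ → ℝ≥0∞) :
    ∫⁻ τ, g τ * ‖waveletAtom ψ a τ‖ₑ ^ 2 =
      ENNReal.ofReal a.2⁻¹ * ∫⁻ u, g (a.1 + a.2 * u) * ‖ψ u‖ₑ ^ 2 := by
  have hpt (τ : ℝ) : g τ * ‖waveletAtom ψ a τ‖ₑ ^ 2 = ENNReal.ofReal (a.2⁻¹ ^ 2) *
      (g (a.1 + a.2 * ((τ - a.1) / a.2)) * ‖ψ ((τ - a.1) / a.2)‖ₑ ^ 2) := by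
    rw [mul_div_cancel₀ _ ha.ne', add_sub_cancel, waveletAtom, enorm_mul, mul_pow,
      ← ofReal_norm (a.2 : ℂ)⁻¹, norm_inv, Complex.norm_real, Real.norm_of_nonneg ha.le,
      ENNReal.ofReal_pow (by positivity)]
    ring
  simp_rw [hpt]
  rw [lintegral_const_mul' _ _ ENNReal.ofReal_ne_top,
    lintegral_comp_sub_div (fun u => g (a.1 + a.2 * u) * ‖ψ u‖ₑ ^ 2) a.1 ha, ← mul_assoc,
    ← ENNReal.ofReal_mul (by positivity)]
  congr 2
  field_simp

theorem memLp_waveletAtom (hψ : Integrable ψ) (hψ₂ : MemLp ψ 2) (ha : 0 < a.2) :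
    MemLp (waveletAtom ψ a) 2 := by
  refine ⟨(integrable_waveletAtom hψ ha).aestronglyMeasurable, ?_⟩
  have h := lintegral_mul_waveletAtom_sq ψ ha fun _ => 1
  simp only [one_mul, lintegral_enorm_sq] at h
  refine (ENNReal.pow_lt_top_iff.1 ?_).resolve_right two_ne_zero
  rw [h]
  exact ENNReal.mul_lt_top ENNReal.ofReal_lt_top (ENNReal.pow_lt_top hψ₂.2)

theorem fourierHat_waveletAtom (ψ : ℝ → ℂ) (ha : 0 < a.2) (x : ℝ) :
    fourierHat (waveletAtom ψ a) x =
      Complex.exp (-(Complex.I * a.1 * x)) * fourierHat ψ (a.2 * x) := by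
  have hs : (a.2 : ℂ) ≠ 0 := by exact_mod_cast ha.ne'
  set F : ℝ → ℂ := fun u => Complex.exp (-(Complex.I * u * (a.2 * x : ℝ))) * ψ u
  have hpt (τ : ℝ) : Complex.exp (-(Complex.I * τ * x)) * waveletAtom ψ a τ =
      Complex.exp (-(Complex.I * a.1 * x)) * ((a.2 : ℂ)⁻¹ * F ((τ - a.1) / a.2)) := by
    have hexp : Complex.exp (-(Complex.I * τ * x)) = Complex.exp (-(Complex.I * a.1 * x)) *
        Complex.exp (-(Complex.I * ((τ - a.1) / a.2 : ℝ) * (a.2 * x : ℝ))) := by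
      rw [← Complex.exp_add]
      congr 1
      push_cast
      field_simp
      ring
    rw [hexp, waveletAtom]
    ring
  simp only [fourierHat, hpt, integral_const_mul]
  rw [integral_sub_right_eq_self (fun y => F (y / a.2)) a.1, Measure.integral_comp_div F a.2,
    abs_of_pos ha, Complex.real_smul, inv_mul_cancel_left₀ hs]

end Atoms

section AtomModulus

variable {ψ : ℝ → ℂ} {C N : ℝ} {a b : ℝ × ℝ}

/-- The pairs `(t, s)` of times `|t| ≤ N` and scales `N⁻¹ ≤ s ≤ N`; these compact sets exhaust the
half-plane `s > 0` as `N → ∞`. -/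
def timeScaleBox (N : ℝ) : Set (ℝ × ℝ) :=
  {a | |a.1| ≤ N ∧ N⁻¹ ≤ a.2 ∧ a.2 ≤ N}

theorem snd_pos_of_mem_timeScaleBox (hN : 0 < N) (ha : a ∈ timeScaleBox N) : 0 < a.2 :=
  (inv_pos.2 hN).trans_le ha.2.1

theorem norm_exp_neg_I_mul_sub_le (t t' x : ℝ) :
    ‖Complex.exp (-(Complex.I * t * x)) - Complex.exp (-(Complex.I * t' * x))‖ ≤
      |t - t'| * |x| := by
  have hfactor : Complex.exp (-(Complex.I * t * x)) - Complex.exp (-(Complex.I * t' * x)) =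
      Complex.exp (-(Complex.I * t' * x)) *
        (Complex.exp (Complex.I * ((t' - t) * x : ℝ)) - 1) := by
    rw [mul_sub, ← Complex.exp_add]
    push_cast
    ring_nf
  rw [hfactor, norm_mul, norm_exp_neg_I_mul, one_mul]
  refine Real.norm_exp_I_mul_ofReal_sub_one_le.trans (le_of_eq ?_)
  rw [Real.norm_eq_abs, abs_mul, abs_sub_comm]

namespace IsRegularWavelet

theorem norm_fourierHat_dilate_sub_le (hψ : IsRegularWavelet ψ C) {s s' : ℝ} (hN : 0 < N)
    (hs : N⁻¹ ≤ s) (hs' : N⁻¹ ≤ s') (x : ℝ) :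
    ‖fourierHat ψ (s * x) - fourierHat ψ (s' * x)‖ ≤ C * N * |s - s'| := by
  wlog h : s' ≤ s generalizing s s'
  · rw [norm_sub_rev, abs_sub_comm]
    exact this hs' hs (le_of_not_ge h)
  have hC := hψ.const_nonneg
  have hs0 : 0 < s' := (inv_pos.2 hN).trans_le hs'
  have hsub : 0 ≤ s - s' := sub_nonneg.2 h
  rcases le_or_gt x 0 with hx | hx
  · rw [hψ.analytic _ (by nlinarith), hψ.analytic _ (by nlinarith), sub_self, norm_zero]
    positivity
  · calc ‖fourierHat ψ (s * x) - fourierHat ψ (s' * x)‖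
        ≤ C * (s * x - s' * x) / (s' * x) :=
          hψ.logLipschitz (s' * x) (s * x) (by positivity) (by gcongr)
      _ = C * s'⁻¹ * (s - s') := by field_simp
      _ ≤ C * N * |s - s'| := by
          rw [abs_of_nonneg hsub]
          gcongr
          exact inv_le_of_inv_le₀ hN hs'

theorem one_add_abs_mul_norm_fourierHat_dilate_le (hψ : IsRegularWavelet ψ C) {s : ℝ} (hN : 1 ≤ N)
    (hs : N⁻¹ ≤ s) (x : ℝ) : (1 + |x|) * ‖fourierHat ψ (s * x)‖ ≤ C * N := by
  have hC := hψ.const_nonneg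
  have hN0 : 0 < N := one_pos.trans_le hN
  have hs0 : 0 < s := (inv_pos.2 hN0).trans_le hs
  have hNs : 1 ≤ s * N := by rwa [inv_le_iff_one_le_mul₀ hN0] at hs
  have hx : 1 + |x| ≤ N * (1 + |s * x|) := by
    rw [abs_mul, abs_of_pos hs0]
    nlinarith [abs_nonneg x]
  calc (1 + |x|) * ‖fourierHat ψ (s * x)‖
      ≤ N * (1 + |s * x|) * (C / (1 + |s * x|)) := by
        gcongr
        exact hψ.decay _
    _ = C * N := by field_simp

theorem fourierHat_waveletAtom_sub (hψ : IsRegularWavelet ψ C) (ha : 0 < a.2) (hb : 0 < b.2)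
    (x : ℝ) : fourierHat (fun τ => waveletAtom ψ a τ - waveletAtom ψ b τ) x =
      Complex.exp (-(Complex.I * a.1 * x)) * fourierHat ψ (a.2 * x) -
        Complex.exp (-(Complex.I * b.1 * x)) * fourierHat ψ (b.2 * x) := by
  rw [fourierHat_sub (integrable_waveletAtom hψ.integrable ha)
    (integrable_waveletAtom hψ.integrable hb), fourierHat_waveletAtom _ ha,
    fourierHat_waveletAtom _ hb]

theorem norm_fourierHat_waveletAtom_sub_le_dist (hψ : IsRegularWavelet ψ C) (hN : 1 ≤ N)
    (ha : a ∈ timeScaleBox N) (hb : b ∈ timeScaleBox N) (x : ℝ) :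
    ‖fourierHat (fun τ => waveletAtom ψ a τ - waveletAtom ψ b τ) x‖ ≤
      2 * C * N * dist a b := by
  have hC := hψ.const_nonneg
  have hN0 : 0 < N := one_pos.trans_le hN
  rw [hψ.fourierHat_waveletAtom_sub (snd_pos_of_mem_timeScaleBox hN0 ha)
    (snd_pos_of_mem_timeScaleBox hN0 hb)]
  have htime : |a.1 - b.1| ≤ dist a b := le_max_left _ _
  have hscale : |a.2 - b.2| ≤ dist a b := le_max_right _ _
  have hdecay := hψ.one_add_abs_mul_norm_fourierHat_dilate_le hN ha.2.1 x
  have hdilate := hψ.norm_fourierHat_dilate_sub_le hN0 ha.2.1 hb.2.1 x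
  have htranslate := norm_exp_neg_I_mul_sub_le a.1 b.1 x
  set e := Complex.exp (-(Complex.I * a.1 * x))
  set e' := Complex.exp (-(Complex.I * b.1 * x))
  have he'_norm : ‖e'‖ = 1 := norm_exp_neg_I_mul b.1 x
  calc ‖e * fourierHat ψ (a.2 * x) - e' * fourierHat ψ (b.2 * x)‖
      = ‖(e - e') * fourierHat ψ (a.2 * x) +
          e' * (fourierHat ψ (a.2 * x) - fourierHat ψ (b.2 * x))‖ := by congr 1; ring
    _ ≤ ‖e - e'‖ * ‖fourierHat ψ (a.2 * x)‖ +
          ‖fourierHat ψ (a.2 * x) - fourierHat ψ (b.2 * x)‖ := by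
        refine (norm_add_le _ _).trans (le_of_eq ?_)
        rw [norm_mul, norm_mul, he'_norm, one_mul]
    _ ≤ |a.1 - b.1| * |x| * ‖fourierHat ψ (a.2 * x)‖ + C * N * |a.2 - b.2| := by gcongr
    _ = |a.1 - b.1| * (|x| * ‖fourierHat ψ (a.2 * x)‖) + C * N * |a.2 - b.2| := by ring
    _ ≤ dist a b * (C * N) + C * N * dist a b := by
        have hdecay' : |x| * ‖fourierHat ψ (a.2 * x)‖ ≤ C * N := by
          linarith [norm_nonneg (fourierHat ψ (a.2 * x))]
        exact add_le_add (mul_le_mul htime hdecay' (by positivity) dist_nonneg) (by gcongr)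
    _ = 2 * C * N * dist a b := by ring

theorem norm_fourierHat_waveletAtom_sub_le_inv (hψ : IsRegularWavelet ψ C) (hN : 1 ≤ N)
    (ha : a ∈ timeScaleBox N) (hb : b ∈ timeScaleBox N) (x : ℝ) :
    ‖fourierHat (fun τ => waveletAtom ψ a τ - waveletAtom ψ b τ) x‖ ≤
      2 * C * N * (1 + |x|)⁻¹ := by
  have hN0 : 0 < N := one_pos.trans_le hN
  rw [hψ.fourierHat_waveletAtom_sub (snd_pos_of_mem_timeScaleBox hN0 ha)
    (snd_pos_of_mem_timeScaleBox hN0 hb), ← div_eq_mul_inv, le_div_iff₀ (by positivity)]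
  have hdecay_a := hψ.one_add_abs_mul_norm_fourierHat_dilate_le hN ha.2.1 x
  have hdecay_b := hψ.one_add_abs_mul_norm_fourierHat_dilate_le hN hb.2.1 x
  calc _ ≤ (‖fourierHat ψ (a.2 * x)‖ + ‖fourierHat ψ (b.2 * x)‖) * (1 + |x|) := by
        gcongr
        refine (norm_sub_le _ _).trans (le_of_eq ?_)
        rw [norm_mul, norm_mul, norm_exp_neg_I_mul, norm_exp_neg_I_mul, one_mul, one_mul]
    _ ≤ 2 * C * N := by linarith

theorem exists_lintegral_waveletAtom_sub_sq_le (hψ : IsRegularWavelet ψ C) :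
    ∃ K : ℝ≥0∞, K ≠ ∞ ∧ ∀ N : ℝ, 1 ≤ N → ∀ a ∈ timeScaleBox N, ∀ b ∈ timeScaleBox N,
      ∫⁻ τ, ‖waveletAtom ψ a τ - waveletAtom ψ b τ‖ₑ ^ 2 ≤
        K * ENNReal.ofReal (N ^ 2 * dist a b ^ (1 / 2 : ℝ)) := by
  set I := ∫⁻ x : ℝ, ENNReal.ofReal ((1 + |x|) ^ (-(3 / 2) : ℝ))
  have hI : I < ∞ := lintegral_one_add_abs_rpow_lt_top (by norm_num)
  refine ⟨ENNReal.ofReal ((2 * C) ^ 2) * I, by finiteness, fun N hN a ha b hb => ?_⟩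
  have hC := hψ.const_nonneg
  have hN0 : 0 < N := one_pos.trans_le hN
  have ha0 := snd_pos_of_mem_timeScaleBox hN0 ha
  have hb0 := snd_pos_of_mem_timeScaleBox hN0 hb
  refine (lintegral_sq_le_lintegral_fourierHat_sq
    ((integrable_waveletAtom hψ.integrable ha0).sub (integrable_waveletAtom hψ.integrable hb0))
    ((memLp_waveletAtom hψ.integrable hψ.memLp_two ha0).sub
      (memLp_waveletAtom hψ.integrable hψ.memLp_two hb0))).trans ?_
  rw [mul_right_comm, ← ENNReal.ofReal_mul (by positivity),
    ← lintegral_const_mul' _ _ ENNReal.ofReal_ne_top]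
  refine lintegral_mono fun x => ?_
  rw [← ofReal_norm, ← ENNReal.ofReal_pow (norm_nonneg _), ← ENNReal.ofReal_mul (by positivity)]
  refine ENNReal.ofReal_le_ofReal ?_
  set y := ‖fourierHat (waveletAtom ψ a - waveletAtom ψ b) x‖
  set B := 2 * C * N with hB
  have hB0 : 0 ≤ B := by positivity
  have hy : 0 ≤ y := norm_nonneg _
  have hdist : y ≤ B * dist a b := hψ.norm_fourierHat_waveletAtom_sub_le_dist hN ha hb x
  have hinv : y ≤ B * (1 + |x|)⁻¹ := hψ.norm_fourierHat_waveletAtom_sub_le_inv hN ha hb x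
  have hsq {z : ℝ} (hz : 0 ≤ z) : z ^ (1 / 2 : ℝ) * z ^ (3 / 2 : ℝ) = z ^ 2 := by
    rw [← Real.rpow_add' hz (by norm_num), ← Real.rpow_natCast]
    norm_num
  calc y ^ 2 = y ^ (1 / 2 : ℝ) * y ^ (3 / 2 : ℝ) := (hsq hy).symm
    _ ≤ (B * dist a b) ^ (1 / 2 : ℝ) * (B * (1 + |x|)⁻¹) ^ (3 / 2 : ℝ) := by gcongr
    _ = B ^ (1 / 2 : ℝ) * B ^ (3 / 2 : ℝ) * dist a b ^ (1 / 2 : ℝ) *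
          (1 + |x|) ^ (-(3 / 2) : ℝ) := by
        rw [Real.mul_rpow hB0 dist_nonneg, Real.mul_rpow hB0 (by positivity),
          Real.rpow_neg (by positivity), Real.inv_rpow (by positivity)]
        ring
    _ = (2 * C) ^ 2 * (N ^ 2 * dist a b ^ (1 / 2 : ℝ)) * (1 + |x|) ^ (-(3 / 2) : ℝ) := by
        rw [hsq hB0, hB]
        ring

end IsRegularWavelet

end AtomModulus

section WeightedIntegrals

variable {α : Type*} [MeasurableSpace α] {μ : Measure α} {w f g : α → ℝ≥0∞}

theorem ennreal_add_sq_le (a b : ℝ≥0∞) : (a + b) ^ 2 ≤ 2 * (a ^ 2 + b ^ 2) := by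
  have h := ENNReal.rpow_add_le_mul_rpow_add_rpow a b (one_le_two : (1 : ℝ) ≤ 2)
  norm_num at h
  exact_mod_cast h

theorem lintegral_rpow_mul_le_rpow_mul_rpow (hw : AEMeasurable w μ) (hg : AEMeasurable g μ) {θ : ℝ}
    (h0 : 0 ≤ θ) (h1 : θ ≤ 1) :
    ∫⁻ x, w x ^ θ * g x ∂μ ≤ (∫⁻ x, g x ∂μ) ^ (1 - θ) * (∫⁻ x, w x * g x ∂μ) ^ θ := by
  refine le_of_eq_of_le (lintegral_congr fun x => ?_) (ENNReal.lintegral_mul_norm_pow_le hg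
    (hw.mul hg) (sub_nonneg.2 h1) h0 (sub_add_cancel 1 θ))
  rw [Pi.mul_apply, ENNReal.mul_rpow_of_nonneg _ _ h0, mul_left_comm,
    ← ENNReal.rpow_add_of_nonneg _ _ (sub_nonneg.2 h1) h0, sub_add_cancel, ENNReal.rpow_one]

theorem sq_lintegral_mul_le (hw : AEMeasurable w μ) (hf : AEMeasurable f μ) (hg : AEMeasurable g μ)
    (hw0 : ∀ x, w x ≠ 0) (hw_top : ∀ x, w x ≠ ∞) :
    (∫⁻ x, f x * g x ∂μ) ^ 2 ≤ (∫⁻ x, (w x)⁻¹ * f x ^ 2 ∂μ) * ∫⁻ x, w x * g x ^ 2 ∂μ := by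
  have hpt (x : α) : f x * g x =
      ((w x)⁻¹ * f x ^ 2) ^ (1 / 2 : ℝ) * (w x * g x ^ 2) ^ (1 / 2 : ℝ) := by
    rw [← ENNReal.mul_rpow_of_nonneg _ _ (by norm_num), mul_mul_mul_comm,
      ENNReal.inv_mul_cancel (hw0 x) (hw_top x), one_mul, ← mul_pow, ← ENNReal.rpow_natCast,
      ← ENNReal.rpow_mul]
    norm_num
  have h := ENNReal.lintegral_mul_norm_pow_le (μ := μ) (hw.inv.mul (hf.pow_const 2))
    (hw.mul (hg.pow_const 2)) one_half_pos.le one_half_pos.le (add_halves 1)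
  simp_rw [Pi.mul_apply, Pi.inv_apply, ← hpt] at h
  refine (pow_le_pow_left' h 2).trans_eq ?_
  rw [← ENNReal.mul_rpow_of_nonneg _ _ (by norm_num), ← ENNReal.rpow_natCast, ← ENNReal.rpow_mul]
  norm_num

theorem lintegral_mul_enorm_sub_sq_le {E : Type*} [SeminormedAddCommGroup E] {u v : α → E}
    (hw : AEMeasurable w μ) (hu : AEStronglyMeasurable u μ) :
    ∫⁻ x, w x * ‖u x - v x‖ₑ ^ 2 ∂μ ≤
      2 * (∫⁻ x, w x * ‖u x‖ₑ ^ 2 ∂μ + ∫⁻ x, w x * ‖v x‖ₑ ^ 2 ∂μ) := by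
  have hmeas : AEMeasurable (fun x => w x * ‖u x‖ₑ ^ 2) μ := hw.mul (hu.enorm.pow_const 2)
  rw [← lintegral_add_left' hmeas, ← lintegral_const_mul' _ _ ENNReal.ofNat_ne_top]
  refine lintegral_mono fun x => ?_
  rw [← mul_add, mul_left_comm]
  gcongr
  exact (pow_le_pow_left' (enorm_sub_le (a := u x)) 2).trans (ennreal_add_sq_le _ _)

end WeightedIntegrals

theorem enorm_complex_ofReal (r : ℝ) : ‖(r : ℂ)‖ₑ = ‖r‖ₑ := by
  rw [← ofReal_norm, Complex.norm_real, ofReal_norm]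

section WeightedAtoms

variable {ψ : ℝ → ℂ} {C N : ℝ} {a b : ℝ × ℝ}

/-- The weight `1 + |τ|`. Powers of it measure the decay of wavelet atoms and the growth of the
paths of a stationary process. -/
noncomputable def weight (τ : ℝ) : ℝ≥0∞ := 1 + ‖τ‖ₑ

theorem measurable_weight : Measurable weight := by
  unfold weight
  fun_prop

theorem weight_ne_zero (τ : ℝ) : weight τ ≠ 0 :=
  (one_pos.trans_le le_self_add).ne'

theorem weight_ne_top (τ : ℝ) : weight τ ≠ ∞ := by
  simp [weight]

theorem weight_eq_ofReal (τ : ℝ) : weight τ = ENNReal.ofReal (1 + |τ|) := by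
  rw [weight, ENNReal.ofReal_add one_pos.le (abs_nonneg τ), ENNReal.ofReal_one,
    ← Real.norm_eq_abs, ofReal_norm]

theorem IsRegularWavelet.lintegral_weight_sq_lt_top (hψ : IsRegularWavelet ψ C) :
    ∫⁻ u, weight u ^ 2 * ‖ψ u‖ₑ ^ 2 < ∞ := by
  have hψ_sq : ∫⁻ u, ‖ψ u‖ₑ ^ 2 < ∞ := by
    rw [lintegral_enorm_sq]
    exact ENNReal.pow_lt_top hψ.memLp_two.2
  have hmeas := hψ.integrable.aestronglyMeasurable.enorm
  calc ∫⁻ u, weight u ^ 2 * ‖ψ u‖ₑ ^ 2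
      ≤ ∫⁻ u : ℝ, 2 * (‖ψ u‖ₑ ^ 2 + ‖(u : ℂ) * ψ u‖ₑ ^ 2) := by
        refine lintegral_mono fun u => ?_
        rw [enorm_mul, mul_pow, enorm_complex_ofReal, ← one_add_mul, ← mul_assoc]
        gcongr
        simpa [weight] using ennreal_add_sq_le 1 ‖u‖ₑ
    _ < ∞ := by
        rw [lintegral_const_mul' _ _ ENNReal.ofNat_ne_top, lintegral_add_left' (hmeas.pow_const 2)]
        exact ENNReal.mul_lt_top ENNReal.ofNat_lt_top
          (ENNReal.add_lt_top.2 ⟨hψ_sq, hψ.lintegral_mul_sq_lt_top⟩)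

theorem lintegral_weight_sq_mul_waveletAtom_sq_le (ψ : ℝ → ℂ) (hN : 1 ≤ N)
    (ha : a ∈ timeScaleBox N) : ∫⁻ τ, weight τ ^ 2 * ‖waveletAtom ψ a τ‖ₑ ^ 2 ≤
      ENNReal.ofReal (4 * N ^ 3) * ∫⁻ u, weight u ^ 2 * ‖ψ u‖ₑ ^ 2 := by
  have hN0 : 0 < N := one_pos.trans_le hN
  have ha0 := snd_pos_of_mem_timeScaleBox hN0 ha
  have hweight (u : ℝ) : weight (a.1 + a.2 * u) ≤ ENNReal.ofReal (2 * N) * weight u := by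
    rw [weight_eq_ofReal, weight_eq_ofReal, ← ENNReal.ofReal_mul (by positivity)]
    refine ENNReal.ofReal_le_ofReal ?_
    calc 1 + |a.1 + a.2 * u| ≤ 1 + (|a.1| + a.2 * |u|) := by
          gcongr
          exact (abs_add_le _ _).trans_eq (by rw [abs_mul, abs_of_pos ha0])
      _ ≤ N + (N + N * |u|) := by
          gcongr
          exacts [ha.1, ha.2.2]
      _ ≤ 2 * N * (1 + |u|) := by nlinarith [abs_nonneg u]
  rw [lintegral_mul_waveletAtom_sq ψ ha0 fun τ => weight τ ^ 2]
  calc ENNReal.ofReal a.2⁻¹ * ∫⁻ u, weight (a.1 + a.2 * u) ^ 2 * ‖ψ u‖ₑ ^ 2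
      ≤ ENNReal.ofReal N * ∫⁻ u, (ENNReal.ofReal (2 * N) * weight u) ^ 2 * ‖ψ u‖ₑ ^ 2 := by
        gcongr with u
        exacts [inv_le_of_inv_le₀ hN0 ha.2.1, hweight u]
    _ = ENNReal.ofReal (4 * N ^ 3) * ∫⁻ u, weight u ^ 2 * ‖ψ u‖ₑ ^ 2 := by
        simp_rw [mul_pow, mul_assoc]
        rw [lintegral_const_mul' _ _ (by finiteness), ← mul_assoc, ← ENNReal.ofReal_pow
          (by positivity), ← ENNReal.ofReal_mul hN0.le]
        ring_nf

theorem lintegral_weight_sq_mul_waveletAtom_sub_sq_le (hψ : Integrable ψ) (hN : 1 ≤ N)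
    (ha : a ∈ timeScaleBox N) (hb : b ∈ timeScaleBox N) :
    ∫⁻ τ, weight τ ^ 2 * ‖waveletAtom ψ a τ - waveletAtom ψ b τ‖ₑ ^ 2 ≤
      ENNReal.ofReal (N ^ 3) * (16 * ∫⁻ u, weight u ^ 2 * ‖ψ u‖ₑ ^ 2) := by
  have hatom := (integrable_waveletAtom hψ
    (snd_pos_of_mem_timeScaleBox (one_pos.trans_le hN) ha)).aestronglyMeasurable
  calc ∫⁻ τ, weight τ ^ 2 * ‖waveletAtom ψ a τ - waveletAtom ψ b τ‖ₑ ^ 2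
      ≤ 2 * ((∫⁻ τ, weight τ ^ 2 * ‖waveletAtom ψ a τ‖ₑ ^ 2) +
          ∫⁻ τ, weight τ ^ 2 * ‖waveletAtom ψ b τ‖ₑ ^ 2) :=
        lintegral_mul_enorm_sub_sq_le (measurable_weight.pow_const 2).aemeasurable hatom
    _ ≤ 2 * (ENNReal.ofReal (4 * N ^ 3) * (∫⁻ u, weight u ^ 2 * ‖ψ u‖ₑ ^ 2) +
          ENNReal.ofReal (4 * N ^ 3) * ∫⁻ u, weight u ^ 2 * ‖ψ u‖ₑ ^ 2) := by
        gcongr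
        exacts [lintegral_weight_sq_mul_waveletAtom_sq_le ψ hN ha,
          lintegral_weight_sq_mul_waveletAtom_sq_le ψ hN hb]
    _ = ENNReal.ofReal (N ^ 3) * (16 * ∫⁻ u, weight u ^ 2 * ‖ψ u‖ₑ ^ 2) := by
        rw [ENNReal.ofReal_mul (by norm_num), ENNReal.ofReal_ofNat]
        ring

theorem lintegral_weight_rpow_mul_sq_le {g : ℝ → ℂ} (hg : AEStronglyMeasurable g) :
    ∫⁻ τ, weight τ ^ (3 / 2 : ℝ) * ‖g τ‖ₑ ^ 2 ≤
      (∫⁻ τ, ‖g τ‖ₑ ^ 2) ^ (1 / 4 : ℝ) * (∫⁻ τ, weight τ ^ 2 * ‖g τ‖ₑ ^ 2) ^ (3 / 4 : ℝ) := by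
  have hinterp := lintegral_rpow_mul_le_rpow_mul_rpow (θ := 3 / 4)
    (measurable_weight.pow_const 2).aemeasurable (hg.enorm.pow_const 2) (by norm_num)
    (by norm_num)
  have hweight (τ : ℝ) : weight τ ^ (3 / 2 : ℝ) = (weight τ ^ 2) ^ (3 / 4 : ℝ) := by
    rw [← ENNReal.rpow_natCast, ← ENNReal.rpow_mul]
    norm_num
  have hquarter : (1 - 3 / 4 : ℝ) = 1 / 4 := by norm_num
  simp_rw [hweight]
  rwa [hquarter] at hinterp

/-- The squared `L²` modulus of the atoms interpolated with the bound for their second moments: the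
exponent `3 / 2` of the weight lies between `0` and `2`, and `weight ^ (-3 / 2)` is integrable. -/
theorem IsRegularWavelet.exists_lintegral_weight_mul_waveletAtom_sub_sq_le
    (hψ : IsRegularWavelet ψ C) :
    ∃ K : ℝ≥0∞, K ≠ ∞ ∧ ∀ N : ℝ, 1 ≤ N → ∀ a ∈ timeScaleBox N, ∀ b ∈ timeScaleBox N,
      ∫⁻ τ, weight τ ^ (3 / 2 : ℝ) * ‖waveletAtom ψ a τ - waveletAtom ψ b τ‖ₑ ^ 2 ≤
        K * ENNReal.ofReal (N ^ 3 * dist a b ^ (1 / 8 : ℝ)) := by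
  obtain ⟨K, hK, hmodulus⟩ := hψ.exists_lintegral_waveletAtom_sub_sq_le
  set D := 16 * ∫⁻ u, weight u ^ 2 * ‖ψ u‖ₑ ^ 2
  have hD : D < ∞ := ENNReal.mul_lt_top ENNReal.ofNat_lt_top hψ.lintegral_weight_sq_lt_top
  refine ⟨K ^ (1 / 4 : ℝ) * D ^ (3 / 4 : ℝ), by finiteness, fun N hN a ha b hb => ?_⟩
  have hN0 : 0 < N := one_pos.trans_le hN
  have hatom {c : ℝ × ℝ} (hc : c ∈ timeScaleBox N) : AEStronglyMeasurable (waveletAtom ψ c) :=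
    (integrable_waveletAtom hψ.integrable (snd_pos_of_mem_timeScaleBox hN0 hc)).1
  calc ∫⁻ τ, weight τ ^ (3 / 2 : ℝ) * ‖waveletAtom ψ a τ - waveletAtom ψ b τ‖ₑ ^ 2
      ≤ (K * ENNReal.ofReal (N ^ 2 * dist a b ^ (1 / 2 : ℝ))) ^ (1 / 4 : ℝ) *
          (ENNReal.ofReal (N ^ 3) * D) ^ (3 / 4 : ℝ) := by
        refine (lintegral_weight_rpow_mul_sq_le ((hatom ha).sub (hatom hb))).trans ?_
        gcongr
        exacts [hmodulus N hN a ha b hb,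
          lintegral_weight_sq_mul_waveletAtom_sub_sq_le hψ.integrable hN ha hb]
    _ = K ^ (1 / 4 : ℝ) * D ^ (3 / 4 : ℝ) * ENNReal.ofReal
          ((N ^ 2 * dist a b ^ (1 / 2 : ℝ)) ^ (1 / 4 : ℝ) * (N ^ 3) ^ (3 / 4 : ℝ)) := by
        rw [ENNReal.mul_rpow_of_nonneg _ _ (by norm_num),
          ENNReal.mul_rpow_of_nonneg _ _ (by norm_num),
          ENNReal.ofReal_rpow_of_nonneg (by positivity) (by norm_num),
          ENNReal.ofReal_rpow_of_nonneg (by positivity) (by norm_num),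
          ENNReal.ofReal_mul (by positivity)]
        ring
    _ ≤ K ^ (1 / 4 : ℝ) * D ^ (3 / 4 : ℝ) *
          ENNReal.ofReal (N ^ 3 * dist a b ^ (1 / 8 : ℝ)) := by
        gcongr _ * ENNReal.ofReal ?_
        rw [Real.mul_rpow (by positivity) (by positivity), ← Real.rpow_mul dist_nonneg,
          mul_right_comm, ← Real.rpow_natCast, ← Real.rpow_natCast, ← Real.rpow_mul hN0.le,
          ← Real.rpow_mul hN0.le, ← Real.rpow_add hN0]
        rw [show (1 / 2 * (1 / 4) : ℝ) = 1 / 8 by norm_num]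
        gcongr
        norm_num

end WeightedAtoms

section SecondOrder

variable {Ω T : Type*} [MeasurableSpace Ω] [MeasurableSpace T] {P : Measure Ω} {μ : Measure T}
  {X : T → Ω → ℂ} {B : ℝ≥0} {g : T → ℂ}

theorem lintegral_enorm_mul_le_eLpNorm_two_mul {u v : Ω → ℂ} (hu : AEStronglyMeasurable u P)
    (hv : AEStronglyMeasurable v P) :
    ∫⁻ ω, ‖u ω * v ω‖ₑ ∂P ≤ eLpNorm u 2 P * eLpNorm v 2 P := by
  simpa [eLpNorm_one_eq_lintegral_enorm] using
    eLpNorm_smul_le_mul_eLpNorm (p := 2) (q := 2) (r := 1) hv hu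

theorem integral_prod_mul_conj [SFinite μ] (f : T → ℂ) :
    ∫ z : T × T, f z.1 * (starRingEnd ℂ) (f z.2) ∂μ.prod μ = ((‖∫ t, f t ∂μ‖ ^ 2 : ℝ) : ℂ) := by
  rw [integral_prod_mul f fun t => (starRingEnd ℂ) (f t), integral_conj, Complex.mul_conj,
    Complex.normSq_eq_norm_sq]

/-- A jointly measurable process with values in `ℂ` whose `L²` norms are bounded by `B`. -/
structure IsSecondOrder (P : Measure Ω) (X : T → Ω → ℂ) (B : ℝ≥0) : Prop where
  measurable : Measurable (Function.uncurry X)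
  eLpNorm_le : ∀ t, eLpNorm (X t) 2 P ≤ B

namespace IsSecondOrder

theorem memLp (h : IsSecondOrder P X B) (t : T) : MemLp (X t) 2 P :=
  ⟨(h.measurable.of_uncurry_left).aestronglyMeasurable,
    (h.eLpNorm_le t).trans_lt ENNReal.coe_lt_top⟩

theorem integrable_mul_mul [SFinite P] [SFinite μ] (h : IsSecondOrder P X B) {y : Ω → ℂ}
    (hy : MemLp y 2 P) (hg : Integrable g μ) :
    Integrable (fun z : Ω × T => y z.1 * (X z.2 z.1 * g z.2)) (P.prod μ) := by
  have hX : Measurable fun z : Ω × T => X z.2 z.1 := h.measurable.comp measurable_swap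
  have hmeas : AEStronglyMeasurable (fun z : Ω × T => y z.1 * (X z.2 z.1 * g z.2)) (P.prod μ) :=
    hy.1.comp_fst.mul (hX.aestronglyMeasurable.mul hg.1.comp_snd)
  refine ⟨hmeas, ?_⟩
  rw [hasFiniteIntegral_iff_enorm, lintegral_prod_symm _ hmeas.enorm]
  calc ∫⁻ t, ∫⁻ ω, ‖y ω * (X t ω * g t)‖ₑ ∂P ∂μ
      ≤ ∫⁻ t, eLpNorm y 2 P * B * ‖g t‖ₑ ∂μ := by
        refine lintegral_mono fun t => ?_
        simp_rw [← mul_assoc, enorm_mul _ (g t)]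
        rw [lintegral_mul_const' _ _ enorm_ne_top]
        gcongr
        exact (lintegral_enorm_mul_le_eLpNorm_two_mul hy.1 (h.memLp t).1).trans
          (by gcongr; exact h.eLpNorm_le t)
    _ < ∞ := by
        have := hy.2.ne
        rw [lintegral_const_mul' _ _ (by finiteness)]
        exact ENNReal.mul_lt_top (by finiteness) hg.2

theorem integrable_mul [IsFiniteMeasure P] [SFinite μ] (h : IsSecondOrder P X B)
    (hg : Integrable g μ) : Integrable (fun z : Ω × T => X z.2 z.1 * g z.2) (P.prod μ) := by
  simpa using h.integrable_mul_mul (memLp_const (1 : ℂ)) hg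

theorem integrable_mul_conj [SFinite P] [SFinite μ] (h : IsSecondOrder P X B)
    (hg : Integrable g μ) :
    Integrable (fun z : Ω × (T × T) => (X z.2.1 z.1 * g z.2.1) *
      (starRingEnd ℂ) (X z.2.2 z.1 * g z.2.2)) (P.prod (μ.prod μ)) := by
  have hX₁ : Measurable fun z : Ω × (T × T) => X z.2.1 z.1 :=
    h.measurable.comp (by fun_prop : Measurable fun z : Ω × (T × T) => (z.2.1, z.1))
  have hX₂ : Measurable fun z : Ω × (T × T) => X z.2.2 z.1 :=
    h.measurable.comp (by fun_prop : Measurable fun z : Ω × (T × T) => (z.2.2, z.1))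
  have hmeas : AEStronglyMeasurable (fun z : Ω × (T × T) => (X z.2.1 z.1 * g z.2.1) *
      (starRingEnd ℂ) (X z.2.2 z.1 * g z.2.2)) (P.prod (μ.prod μ)) :=
    (hX₁.aestronglyMeasurable.mul hg.1.comp_fst.comp_snd).mul
      (Complex.continuous_conj.comp_aestronglyMeasurable
        (hX₂.aestronglyMeasurable.mul hg.1.comp_snd.comp_snd))
  refine ⟨hmeas, ?_⟩
  rw [hasFiniteIntegral_iff_enorm, lintegral_prod_symm _ hmeas.enorm]
  calc ∫⁻ z : T × T, ∫⁻ ω, ‖(X z.1 ω * g z.1) * (starRingEnd ℂ) (X z.2 ω * g z.2)‖ₑ ∂P ∂μ.prod μ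
      ≤ ∫⁻ z : T × T, B * B * (‖g z.1‖ₑ * ‖g z.2‖ₑ) ∂μ.prod μ := by
        refine lintegral_mono fun z => ?_
        simp_rw [enorm_mul, RCLike.enorm_conj, enorm_mul, mul_mul_mul_comm _ ‖g z.1‖ₑ]
        rw [lintegral_mul_const' _ _ (by finiteness)]
        gcongr
        simp_rw [← enorm_mul]
        exact (lintegral_enorm_mul_le_eLpNorm_two_mul (h.memLp _).1 (h.memLp _).1).trans
          (by gcongr <;> exact h.eLpNorm_le _)
    _ < ∞ := by
        have := hg.2.ne
        rw [lintegral_const_mul' _ _ (by finiteness), lintegral_prod_mul hg.1.enorm hg.1.enorm]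
        finiteness

theorem memLp_integral_mul [IsFiniteMeasure P] [SFinite μ] (h : IsSecondOrder P X B)
    (hg : Integrable g μ) : MemLp (fun ω => ∫ t, X t ω * g t ∂μ) 2 P := by
  rw [memLp_two_iff_integrable_sq_norm
    (h.integrable_mul hg).integral_prod_left.aestronglyMeasurable]
  have hint := (h.integrable_mul_conj hg).integral_prod_left.congr
    (ae_of_all _ fun ω => integral_prod_mul_conj fun t => X t ω * g t)
  exact_mod_cast hint.re

theorem integral_mul_mem_topologicalClosure_span [IsFiniteMeasure P] [SFinite μ]
    (h : IsSecondOrder P X B) (hg : Integrable g μ) :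
    (h.memLp_integral_mul hg).toLp _ ∈
      (Submodule.span ℂ (range fun t => (h.memLp t).toLp (X t))).topologicalClosure := by
  rw [← Submodule.orthogonal_orthogonal_eq_closure, Submodule.mem_orthogonal]
  intro y hy
  have hy_eval (t : T) : ∫ ω, (starRingEnd ℂ) (y ω) * X t ω ∂P = 0 := by
    have hinner := (Submodule.mem_orthogonal' _ _).1 hy _ (Submodule.subset_span ⟨t, rfl⟩)
    rw [L2.inner_def] at hinner
    rw [← hinner]
    refine integral_congr_ae ?_
    filter_upwards [(h.memLp t).coeFn_toLp] with ω hω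
    rw [hω, RCLike.inner_apply']
  calc inner ℂ y ((h.memLp_integral_mul hg).toLp _)
      = ∫ ω, ∫ t, (starRingEnd ℂ) (y ω) * (X t ω * g t) ∂μ ∂P := by
        rw [L2.inner_def]
        refine integral_congr_ae ?_
        filter_upwards [(h.memLp_integral_mul hg).coeFn_toLp] with ω hω
        rw [hω, integral_const_mul, RCLike.inner_apply']
    _ = ∫ t, ∫ ω, (starRingEnd ℂ) (y ω) * (X t ω * g t) ∂P ∂μ :=
        integral_integral_swap (h.integrable_mul_mul (Lp.memLp y).star hg)
    _ = 0 := by simp_rw [← mul_assoc, integral_mul_const, hy_eval, zero_mul, integral_zero]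

theorem ae_lintegral_mul_sq_lt_top [SFinite P] [SFinite μ] (h : IsSecondOrder P X B)
    {w : T → ℝ≥0∞} (hw : Measurable w) (hw_top : ∀ t, w t ≠ ∞) (hw_int : ∫⁻ t, w t ∂μ < ∞) :
    ∀ᵐ ω ∂P, ∫⁻ t, w t * ‖X t ω‖ₑ ^ 2 ∂μ < ∞ := by
  have hmeas : Measurable fun z : Ω × T => w z.2 * ‖X z.2 z.1‖ₑ ^ 2 := by
    have hX : Measurable fun z : Ω × T => X z.2 z.1 := h.measurable.comp measurable_swap
    exact (hw.comp measurable_snd).mul (hX.enorm.pow_const 2)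
  refine ae_lt_top hmeas.lintegral_prod_right' (lt_top_iff_ne_top.1 ?_)
  rw [lintegral_lintegral_swap hmeas.aemeasurable]
  calc ∫⁻ t, ∫⁻ ω, w t * ‖X t ω‖ₑ ^ 2 ∂P ∂μ ≤ ∫⁻ t, w t * (B : ℝ≥0∞) ^ 2 ∂μ := by
        refine lintegral_mono fun t => ?_
        rw [lintegral_const_mul' _ _ (hw_top t), lintegral_enorm_sq]
        gcongr
        exact h.eLpNorm_le t
    _ < ∞ := by
        rw [lintegral_mul_const' _ _ (by finiteness)]
        exact ENNReal.mul_lt_top hw_int (by finiteness)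

end IsSecondOrder

end SecondOrder

section SpectralDensity

variable {Ω : Type*} [MeasurableSpace Ω] {P : Measure Ω} {X : ℝ → Ω → ℂ} {p : ℝ → ℝ} {g : ℝ → ℂ}

/-- A jointly measurable, square integrable process with values in `ℂ`, stationary in the wide
sense with spectral density `p`. The covariances are represented by the moments `E[X a * conj X b]`,
so that `X` is understood to be centered. -/
structure IsWideSenseStationary (P : Measure Ω) (X : ℝ → Ω → ℂ) (p : ℝ → ℝ) : Prop where
  measurable : Measurable (Function.uncurry X)
  memLp : ∀ t, MemLp (X t) 2 P
  nonneg : ∀ x, 0 ≤ p x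
  integrable : Integrable p
  integral_mul_conj : ∀ a b, ∫ ω, X a ω * (starRingEnd ℂ) (X b ω) ∂P =
    ∫ x : ℝ, Complex.exp (Complex.I * (a - b : ℝ) * x) * (p x : ℂ)

theorem integrable_exp_mul_conj_mul (hg : Integrable g) (hp : Integrable p) :
    Integrable (fun z : (ℝ × ℝ) × ℝ =>
      (Complex.exp (-(Complex.I * z.1.1 * (-z.2 : ℝ))) * g z.1.1) *
        (starRingEnd ℂ) (Complex.exp (-(Complex.I * z.1.2 * (-z.2 : ℝ))) * g z.1.2) * (p z.2 : ℂ))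
      ((volume.prod volume).prod volume) := by
  have hgg : Integrable (fun z : ℝ × ℝ => g z.1 * (starRingEnd ℂ) (g z.2)) :=
    hg.mul_prod ((LinearIsometryEquiv.integrable_comp_iff Complex.conjLIE).2 hg)
  have hexp : Continuous fun z : (ℝ × ℝ) × ℝ =>
      Complex.exp (-(Complex.I * z.1.1 * (-z.2 : ℝ))) *
        (starRingEnd ℂ) (Complex.exp (-(Complex.I * z.1.2 * (-z.2 : ℝ)))) :=
    Continuous.mul (by fun_prop) (Complex.continuous_conj.comp (by fun_prop))
  refine ((hgg.mul_prod hp.ofReal).bdd_mul (c := 1) hexp.aestronglyMeasurable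
    (ae_of_all _ fun z => ?_)).congr (ae_of_all _ fun z => ?_)
  · rw [norm_mul, RCLike.norm_conj, norm_exp_neg_I_mul, norm_exp_neg_I_mul, one_mul]
  · simp only [map_mul, Complex.coe_algebraMap]
    ring

theorem norm_fourierHat_conj_neg (g : ℝ → ℂ) (x : ℝ) :
    ‖fourierHat (fun t => (starRingEnd ℂ) (g t)) (-x)‖ = ‖fourierHat g x‖ := by
  rw [← RCLike.norm_conj (fourierHat g x), fourierHat, fourierHat, ← integral_conj]
  congr 2 with t
  rw [map_mul, ← Complex.exp_conj]
  simp

namespace IsWideSenseStationary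

theorem eLpNorm_sq_eq (h : IsWideSenseStationary P X p) (t : ℝ) :
    eLpNorm (X t) 2 P ^ 2 = ∫⁻ x, ENNReal.ofReal (p x) := by
  have hmoment : ∫ ω, ‖X t ω‖ ^ 2 ∂P = ∫ x, p x := by
    have := h.integral_mul_conj t t
    simp only [Complex.mul_conj, Complex.normSq_eq_norm_sq, sub_self, Complex.ofReal_zero, mul_zero,
      zero_mul, Complex.exp_zero, one_mul, integral_complex_ofReal] at this
    exact_mod_cast this
  rw [← lintegral_enorm_sq, ← ofReal_integral_eq_lintegral_ofReal h.integrable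
    (ae_of_all _ h.nonneg), ← hmoment, ofReal_integral_eq_lintegral_ofReal
    ((memLp_two_iff_integrable_sq_norm (h.memLp t).1).1 (h.memLp t))
    (ae_of_all _ fun ω => sq_nonneg _)]
  simp_rw [ENNReal.ofReal_pow (norm_nonneg _), ofReal_norm]

theorem exists_isSecondOrder (h : IsWideSenseStationary P X p) : ∃ B, IsSecondOrder P X B := by
  refine ⟨(eLpNorm (X 0) 2 P).toNNReal, h.measurable, fun t => le_of_eq ?_⟩
  rw [ENNReal.coe_toNNReal (h.memLp 0).2.ne]
  exact (ENNReal.pow_right_strictMono two_ne_zero).injective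
    ((h.eLpNorm_sq_eq t).trans (h.eLpNorm_sq_eq 0).symm)

theorem integral_mul_conj_mul (h : IsWideSenseStationary P X p) (g : ℝ → ℂ) (a b : ℝ) :
    ∫ ω, (X a ω * g a) * (starRingEnd ℂ) (X b ω * g b) ∂P =
      ∫ x : ℝ, (Complex.exp (-(Complex.I * a * (-x : ℝ))) * g a) *
        (starRingEnd ℂ) (Complex.exp (-(Complex.I * b * (-x : ℝ))) * g b) * (p x : ℂ) := by
  simp_rw [map_mul, mul_mul_mul_comm _ (g a)]
  rw [integral_mul_const, h.integral_mul_conj, ← integral_mul_const]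
  congr 1 with x
  have hexp : Complex.exp (Complex.I * (a - b : ℝ) * x) =
      Complex.exp (-(Complex.I * a * (-x : ℝ))) *
        (starRingEnd ℂ) (Complex.exp (-(Complex.I * b * (-x : ℝ)))) := by
    rw [← Complex.exp_conj, ← Complex.exp_add]
    congr 1
    simp only [Complex.ofReal_sub, Complex.ofReal_neg, mul_neg, neg_neg, map_mul, Complex.conj_I,
      Complex.conj_ofReal, neg_mul]
    ring
  rw [hexp, mul_right_comm]

theorem integral_norm_sq_integral_mul [IsFiniteMeasure P] (h : IsWideSenseStationary P X p)
    (hg : Integrable g) :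
    ∫ ω, ‖∫ t, X t ω * g t‖ ^ 2 ∂P = ∫ x, ‖fourierHat g (-x)‖ ^ 2 * p x := by
  obtain ⟨B, hB⟩ := h.exists_isSecondOrder
  refine Complex.ofReal_injective ?_
  rw [← integral_complex_ofReal, ← integral_complex_ofReal]
  calc ∫ ω, ((‖∫ t, X t ω * g t‖ ^ 2 : ℝ) : ℂ) ∂P
      = ∫ ω, ∫ z : ℝ × ℝ, (X z.1 ω * g z.1) * (starRingEnd ℂ) (X z.2 ω * g z.2)
          ∂volume.prod volume ∂P := by
        simp_rw [← integral_prod_mul_conj fun t => X t _ * g t]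
    _ = ∫ z : ℝ × ℝ, ∫ ω, (X z.1 ω * g z.1) * (starRingEnd ℂ) (X z.2 ω * g z.2) ∂P
          ∂volume.prod volume := integral_integral_swap (hB.integrable_mul_conj hg)
    _ = ∫ x : ℝ, ∫ z : ℝ × ℝ, (Complex.exp (-(Complex.I * z.1 * (-x : ℝ))) * g z.1) *
          (starRingEnd ℂ) (Complex.exp (-(Complex.I * z.2 * (-x : ℝ))) * g z.2) * (p x : ℂ)
          ∂volume.prod volume := by
        simp_rw [h.integral_mul_conj_mul]
        exact integral_integral_swap (integrable_exp_mul_conj_mul hg h.integrable)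
    _ = ∫ x : ℝ, ((‖fourierHat g (-x)‖ ^ 2 * p x : ℝ) : ℂ) := by
        congr 1 with x
        rw [integral_mul_const, integral_prod_mul_conj fun t : ℝ =>
          Complex.exp (-(Complex.I * t * (-x : ℝ))) * g t, Complex.ofReal_mul]
        rfl

theorem lintegral_sq_integral_mul_conj [IsFiniteMeasure P] (h : IsWideSenseStationary P X p)
    (hg : Integrable g) :
    ∫⁻ ω, ‖∫ t, X t ω * (starRingEnd ℂ) (g t)‖ₑ ^ 2 ∂P =
      ∫⁻ x, ‖fourierHat g x‖ₑ ^ 2 * ENNReal.ofReal (p x) := by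
  obtain ⟨B, hB⟩ := h.exists_isSecondOrder
  have hg' := (LinearIsometryEquiv.integrable_comp_iff Complex.conjLIE).2 hg
  have hspec : Integrable fun x => ‖fourierHat g x‖ ^ 2 * p x :=
    h.integrable.bdd_mul (c := (∫ t, ‖g t‖) ^ 2)
      ((continuous_fourierHat hg).norm.pow 2).aestronglyMeasurable
      (ae_of_all _ fun x => by
        rw [norm_pow, norm_norm]
        gcongr
        exact norm_fourierHat_le g x)
  have hmoment : ∫ ω, ‖∫ t, X t ω * (starRingEnd ℂ) (g t)‖ ^ 2 ∂P =
      ∫ x, ‖fourierHat g x‖ ^ 2 * p x := by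
    simp_rw [← norm_fourierHat_conj_neg g]
    exact h.integral_norm_sq_integral_mul hg'
  calc ∫⁻ ω, ‖∫ t, X t ω * (starRingEnd ℂ) (g t)‖ₑ ^ 2 ∂P
      = ∫⁻ ω, ENNReal.ofReal (‖∫ t, X t ω * (starRingEnd ℂ) (g t)‖ ^ 2) ∂P := by
        simp_rw [ENNReal.ofReal_pow (norm_nonneg _), ofReal_norm]
    _ = ∫⁻ x, ENNReal.ofReal (‖fourierHat g x‖ ^ 2 * p x) := by
        rw [← ofReal_integral_eq_lintegral_ofReal _ (ae_of_all _ fun ω => sq_nonneg _), hmoment,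
          ofReal_integral_eq_lintegral_ofReal hspec
            (ae_of_all _ fun x => mul_nonneg (sq_nonneg _) (h.nonneg x))]
        have hL2 := hB.memLp_integral_mul hg'
        exact (memLp_two_iff_integrable_sq_norm hL2.1).1 hL2
    _ = ∫⁻ x, ‖fourierHat g x‖ₑ ^ 2 * ENNReal.ofReal (p x) := by
        simp_rw [ENNReal.ofReal_mul (sq_nonneg _), ENNReal.ofReal_pow (norm_nonneg _), ofReal_norm]

end IsWideSenseStationary

end SpectralDensity

section GaussianMoments

theorem eLpNorm_id_gaussianReal (v : ℝ≥0) (q : ℝ≥0∞) :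
    eLpNorm id q (gaussianReal 0 v) = ‖√(v : ℝ)‖ₑ * eLpNorm id q (gaussianReal 0 1) := by
  have hscale : gaussianReal 0 v = (gaussianReal 0 1).map (√(v : ℝ) * ·) := by
    rw [gaussianReal_map_const_mul]
    congr 1
    · simp
    · ext; simp
  rw [hscale, eLpNorm_map_measure (by fun_prop) (by fun_prop)]
  exact eLpNorm_const_smul (√(v : ℝ)) (id : ℝ → ℝ) q _

theorem eLpNorm_two_id_gaussianReal : eLpNorm id 2 (gaussianReal 0 1) = 1 := by
  have hvar := variance_id_gaussianReal (μ := 0) (v := 1)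
  rw [variance_eq_integral (by fun_prop)] at hvar
  simp only [id, integral_id_gaussianReal, sub_zero, NNReal.coe_one] at hvar
  refine (ENNReal.pow_right_strictMono two_ne_zero).injective ?_
  rw [← lintegral_enorm_sq, one_pow, ← ENNReal.ofReal_one, ← hvar,
    ofReal_integral_eq_lintegral_ofReal (f := fun x : ℝ => x ^ 2)
      (memLp_id_gaussianReal' 2 (by norm_num)).integrable_sq (ae_of_all _ fun x => sq_nonneg x)]
  refine lintegral_congr fun x => ?_
  rw [← sq_abs, ENNReal.ofReal_pow (abs_nonneg _), ← Real.norm_eq_abs, ofReal_norm, id]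

/-- The ratio of the `L^q` and `L²` norms of a centered real Gaussian variable. -/
noncomputable def gaussianMomentConst (q : ℝ≥0∞) : ℝ≥0∞ := eLpNorm id q (gaussianReal 0 1)

theorem gaussianMomentConst_ne_top {q : ℝ≥0∞} (hq : q ≠ ∞) : gaussianMomentConst q ≠ ∞ :=
  (memLp_id_gaussianReal' q hq).2.ne

variable {Ω T : Type*} [MeasurableSpace Ω] {P : Measure Ω}

theorem eLpNorm_eq_of_hasLaw_gaussianReal {X : Ω → ℝ} {v : ℝ≥0} (h : HasLaw X (gaussianReal 0 v) P)
    (q : ℝ≥0∞) : eLpNorm X q P = gaussianMomentConst q * eLpNorm X 2 P := by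
  have heq (r : ℝ≥0∞) : eLpNorm X r P = eLpNorm id r (gaussianReal 0 v) := by
    rw [← h.map_eq, eLpNorm_map_measure (by fun_prop) h.aemeasurable]
    rfl
  rw [heq, heq, eLpNorm_id_gaussianReal, eLpNorm_id_gaussianReal v 2, eLpNorm_two_id_gaussianReal,
    mul_one, gaussianMomentConst, mul_comm]

theorem eLpNorm_le_two_mul_of_re_of_im {f : Ω → ℂ} (hf : AEStronglyMeasurable f P)
    {q K : ℝ≥0∞} (hq : 1 ≤ q)
    (hre : eLpNorm (fun ω => (f ω).re) q P ≤ K * eLpNorm (fun ω => (f ω).re) 2 P)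
    (him : eLpNorm (fun ω => (f ω).im) q P ≤ K * eLpNorm (fun ω => (f ω).im) 2 P) :
    eLpNorm f q P ≤ 2 * K * eLpNorm f 2 P := by
  have hmeas_re : AEStronglyMeasurable (fun ω => (f ω).re) P := hf.re
  have hmeas_im : AEStronglyMeasurable (fun ω => (f ω).im) P := hf.im
  calc eLpNorm f q P
      ≤ eLpNorm ((fun ω => ‖(f ω).re‖) + fun ω => ‖(f ω).im‖) q P :=
        eLpNorm_mono_real fun ω => Complex.norm_le_abs_re_add_abs_im _
    _ ≤ eLpNorm (fun ω => (f ω).re) q P + eLpNorm (fun ω => (f ω).im) q P := by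
        simpa only [eLpNorm_norm] using eLpNorm_add_le hmeas_re.norm hmeas_im.norm hq
    _ ≤ K * eLpNorm f 2 P + K * eLpNorm f 2 P :=
        add_le_add
          (hre.trans (by gcongr; exact eLpNorm_mono fun ω => Complex.abs_re_le_norm _))
          (him.trans (by gcongr; exact eLpNorm_mono fun ω => Complex.abs_im_le_norm _))
    _ = 2 * K * eLpNorm f 2 P := by rw [← two_mul, mul_assoc]

/-- The process `Φ` minus its mean function, regarded as a process with values in `ℂ`. -/
noncomputable def centered (P : Measure Ω) (Φ : T → Ω → ℝ) (t : T) (ω : Ω) : ℂ :=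
  ((Φ t ω - ∫ ω', Φ t ω' ∂P : ℝ) : ℂ)

theorem exists_hasLaw_gaussianReal_sum_mul_sub_integral {Φ : T → Ω → ℝ}
    (hΦ : IsGaussianProcess Φ P) (I : Finset T) (c : T → ℝ) :
    ∃ v : ℝ≥0, HasLaw (fun ω => ∑ t ∈ I, c t * (Φ t ω - ∫ ω', Φ t ω' ∂P))
      (gaussianReal 0 v) P := by
  let L : (I → ℝ) →L[ℝ] ℝ := ∑ i : I, c i • ContinuousLinearMap.proj i
  have hgauss : HasGaussianLaw (fun ω => ∑ t ∈ I, c t * Φ t ω) P := by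
    refine ((hΦ.hasGaussianLaw I).map_fun L).congr (ae_of_all _ fun ω => ?_)
    simp [L, ← Finset.sum_coe_sort I]
  have hmean : (P.map fun ω => ∑ t ∈ I, c t * Φ t ω)[id] =
      ∑ t ∈ I, c t * ∫ ω, Φ t ω ∂P := by
    rw [integral_map hgauss.aemeasurable (by fun_prop)]
    simp_rw [id, ← integral_const_mul]
    exact integral_finsetSum _ fun t _ => (hΦ.hasGaussianLaw_eval t).integrable.const_mul _
  have hlaw : HasLaw (fun ω => ∑ t ∈ I, c t * Φ t ω)
      (gaussianReal (∑ t ∈ I, c t * ∫ ω, Φ t ω ∂P)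
        Var[id; P.map fun ω => ∑ t ∈ I, c t * Φ t ω].toNNReal) P := by
    refine ⟨hgauss.aemeasurable, ?_⟩
    rw [← hmean]
    exact IsGaussian.eq_gaussianReal _ hgauss.isGaussian_map
  have hcentered := gaussianReal_sub_const hlaw (∑ t ∈ I, c t * ∫ ω, Φ t ω ∂P)
  rw [sub_self] at hcentered
  refine ⟨_, hcentered.congr (ae_of_all _ fun ω => ?_)⟩
  simp only [mul_sub, Finset.sum_sub_distrib]

theorem eLpNorm_sum_mul_centered_le {Φ : T → Ω → ℝ} (hΦ : IsGaussianProcess Φ P) {q : ℝ≥0∞}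
    (hq : 1 ≤ q) (I : Finset T) (c : T → ℂ) :
    eLpNorm (fun ω => ∑ t ∈ I, c t * centered P Φ t ω) q P ≤
      2 * gaussianMomentConst q * eLpNorm (fun ω => ∑ t ∈ I, c t * centered P Φ t ω) 2 P := by
  obtain ⟨v, hv⟩ := exists_hasLaw_gaussianReal_sum_mul_sub_integral hΦ I fun t => (c t).re
  obtain ⟨w, hw⟩ := exists_hasLaw_gaussianReal_sum_mul_sub_integral hΦ I fun t => (c t).im
  have hmeas : AEStronglyMeasurable (fun ω => ∑ t ∈ I, c t * centered P Φ t ω) P :=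
    Finset.aestronglyMeasurable_fun_sum I fun t _ =>
      (Complex.continuous_ofReal.comp_aestronglyMeasurable
        ((hΦ.hasGaussianLaw_eval t).integrable.1.sub aestronglyMeasurable_const)).const_mul _
  refine eLpNorm_le_two_mul_of_re_of_im hmeas hq ?_ ?_
  · simpa only [Complex.re_sum, centered, Complex.re_mul_ofReal] using
      (eLpNorm_eq_of_hasLaw_gaussianReal hv q).le
  · simpa only [Complex.im_sum, centered, Complex.im_mul_ofReal] using
      (eLpNorm_eq_of_hasLaw_gaussianReal hw q).le

theorem eLpNorm_le_of_mem_closure {S : Set (Lp ℂ 2 P)} {q K : ℝ≥0∞} (hK : K ≠ ∞)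
    (hS : ∀ f ∈ S, eLpNorm f q P ≤ K * eLpNorm f 2 P) {f : Lp ℂ 2 P} (hf : f ∈ closure S) :
    eLpNorm f q P ≤ K * eLpNorm f 2 P := by
  obtain ⟨u, hu, hlim⟩ := mem_closure_iff_seq_limit.1 hf
  obtain ⟨ns, hns, hae⟩ := (tendstoInMeasure_of_tendsto_Lp hlim).exists_seq_tendsto_ae
  refine (Lp.eLpNorm_lim_le_liminf_eLpNorm (fun n => Lp.aestronglyMeasurable (u (ns n))) _
    hae).trans ?_
  have hlim_norm : Tendsto (fun n => K * eLpNorm (u (ns n)) 2 P) atTop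
      (𝓝 (K * eLpNorm f 2 P)) := by
    refine ENNReal.Tendsto.const_mul ?_ (Or.inr hK)
    simp_rw [← Lp.enorm_def]
    exact (hlim.comp hns.tendsto_atTop).enorm
  rw [← hlim_norm.liminf_eq]
  exact liminf_le_liminf (Eventually.of_forall fun n => hS _ (hu _))

theorem exists_ae_eq_sum_of_mem_span_range_toLp {X : T → Ω → ℂ} (hX : ∀ t, MemLp (X t) 2 P)
    {f : Lp ℂ 2 P} (hf : f ∈ Submodule.span ℂ (range fun t => (hX t).toLp (X t))) :
    ∃ (I : Finset T) (c : T → ℂ), f =ᵐ[P] fun ω => ∑ t ∈ I, c t * X t ω := by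
  obtain ⟨c, rfl⟩ := Finsupp.mem_span_range_iff_exists_finsupp.1 hf
  have hterm : ∀ᵐ ω ∂P, ∀ t ∈ c.support, (c t • (hX t).toLp (X t) : Lp ℂ 2 P) ω = c t * X t ω := by
    refine (ae_ball_iff c.support.countable_toSet).2 fun t _ => ?_
    filter_upwards [Lp.coeFn_smul (c t) ((hX t).toLp (X t)), (hX t).coeFn_toLp] with ω h_smul h_toLp
    rw [h_smul, Pi.smul_apply, h_toLp, smul_eq_mul]
  refine ⟨c.support, c, ?_⟩
  filter_upwards [Lp.coeFn_finsetSum c.support (fun t => c t • (hX t).toLp (X t)), hterm]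
    with ω h_sum h_term
  rw [Finsupp.sum, h_sum, Finset.sum_apply]
  exact Finset.sum_congr rfl h_term

theorem IsSecondOrder.eLpNorm_integral_mul_le [IsFiniteMeasure P] [MeasurableSpace T]
    {μ : Measure T} [SFinite μ] {X : T → Ω → ℂ} {B : ℝ≥0} (h : IsSecondOrder P X B) {q K : ℝ≥0∞}
    (hK : K ≠ ∞) (hsum : ∀ (I : Finset T) (c : T → ℂ), eLpNorm (fun ω => ∑ t ∈ I, c t * X t ω) q P ≤
      K * eLpNorm (fun ω => ∑ t ∈ I, c t * X t ω) 2 P)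
    {g : T → ℂ} (hg : Integrable g μ) :
    eLpNorm (fun ω => ∫ t, X t ω * g t ∂μ) q P ≤
      K * eLpNorm (fun ω => ∫ t, X t ω * g t ∂μ) 2 P := by
  have hspan : ∀ f ∈ (Submodule.span ℂ (range fun t => (h.memLp t).toLp (X t)) : Set (Lp ℂ 2 P)),
      eLpNorm f q P ≤ K * eLpNorm f 2 P := by
    intro f hf
    obtain ⟨I, c, hfc⟩ := exists_ae_eq_sum_of_mem_span_range_toLp h.memLp hf
    rw [eLpNorm_congr_ae hfc, eLpNorm_congr_ae hfc]
    exact hsum I c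
  simpa only [eLpNorm_congr_ae (h.memLp_integral_mul hg).coeFn_toLp] using
    eLpNorm_le_of_mem_closure hK hspan (h.integral_mul_mem_topologicalClosure_span hg)

end GaussianMoments

section GaussianStationary

variable {Ω : Type*} [MeasurableSpace Ω] {P : Measure Ω} {Φ : ℝ → Ω → ℝ} {p : ℝ → ℝ} {g : ℝ → ℂ}

theorem IsStationaryProcess.identDistrib (h : IsStationaryProcess P Φ) (t : ℝ) :
    IdentDistrib (Φ t) (Φ 0) P P := by
  simpa [Function.comp_def] using (h t {0}).comp
    (u := fun x : ({0} : Finset ℝ) → ℝ => x ⟨0, by simp⟩) (by fun_prop)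

theorem IsStationaryProcess.identDistrib_prodMk (h : IsStationaryProcess P Φ) (a b : ℝ) :
    IdentDistrib (fun ω => (Φ a ω, Φ b ω)) (fun ω => (Φ (a - b) ω, Φ 0 ω)) P P := by
  simpa [Function.comp_def] using (h b {a - b, 0}).comp
    (u := fun x : ({a - b, 0} : Finset ℝ) → ℝ => (x ⟨a - b, by simp⟩, x ⟨0, by simp⟩))
    (by fun_prop)

theorem IsStationaryProcess.centered_eq (h : IsStationaryProcess P Φ) (t : ℝ) (ω : Ω) :
    centered P Φ t ω = ((Φ t ω - ∫ ω', Φ 0 ω' ∂P : ℝ) : ℂ) := by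
  rw [centered, (h.identDistrib t).integral_eq]

theorem isWideSenseStationary_centered [IsFiniteMeasure P]
    (hmeas : Measurable (Function.uncurry Φ)) (hL2 : ∀ t, MemLp (Φ t) 2 P)
    (hstat : IsStationaryProcess P Φ) (hp : IsSpectralDensity P Φ p) :
    IsWideSenseStationary P (centered P Φ) p where
  measurable := by
    rw [show centered P Φ = fun t ω => ((Φ t ω - ∫ ω', Φ 0 ω' ∂P : ℝ) : ℂ) from
      funext fun t => funext fun ω => hstat.centered_eq t ω]
    exact Complex.measurable_ofReal.comp (hmeas.sub_const _)
  memLp t := ((hL2 t).sub (memLp_const _)).ofReal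
  nonneg x := (hp.pos x).le
  integrable := hp.integrable
  integral_mul_conj a b := by
    have hpair := ((hstat.identDistrib_prodMk a b).comp (u := fun x : ℝ × ℝ =>
      (x.1 - ∫ ω, Φ 0 ω ∂P) * (x.2 - ∫ ω, Φ 0 ω ∂P)) (by fun_prop)).integral_eq
    simp only [Function.comp_def] at hpair
    simp_rw [hstat.centered_eq, Complex.conj_ofReal, ← Complex.ofReal_mul]
    rw [integral_complex_ofReal, hpair, ← hp.cov_eq, covariance,
      (hstat.identDistrib (a - b)).integral_eq]

theorem lintegral_pow_integral_centered_mul_conj_le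
    (hΦ : IsGaussianProcess Φ P) (hX : IsWideSenseStationary P (centered P Φ) p)
    (hg : Integrable g) {k : ℕ} (hk : k ≠ 0) :
    ∫⁻ ω, ‖∫ τ, centered P Φ τ ω * (starRingEnd ℂ) (g τ)‖ₑ ^ (2 * k) ∂P ≤
      (2 * gaussianMomentConst (2 * k : ℕ)) ^ (2 * k) *
        (∫⁻ x, ‖fourierHat g x‖ₑ ^ 2 * ENNReal.ofReal (p x)) ^ k := by
  have := hΦ.isProbabilityMeasure
  obtain ⟨B, hB⟩ := hX.exists_isSecondOrder
  have htop : 2 * gaussianMomentConst (2 * k : ℕ) ≠ ∞ :=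
    ENNReal.mul_ne_top (by simp) (gaussianMomentConst_ne_top (ENNReal.natCast_ne_top _))
  have hmoment := hB.eLpNorm_integral_mul_le htop
    (fun I c => eLpNorm_sum_mul_centered_le hΦ (by exact_mod_cast (by lia : 1 ≤ 2 * k)) I c)
    ((LinearIsometryEquiv.integrable_comp_iff Complex.conjLIE).2 hg)
  rw [← hX.lintegral_sq_integral_mul_conj hg, lintegral_enorm_sq, ← pow_mul, ← mul_pow,
    lintegral_enorm_pow _ (by lia : 2 * k ≠ 0)]
  exact pow_le_pow_left' hmoment _

end GaussianStationary

section SpectralMeasure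

/-- The measure on `ℝ` with density `p`: the spectral measure of a stationary process with
spectral density `p`. -/
noncomputable def spectralMeasure (p : ℝ → ℝ) : Measure ℝ :=
  volume.withDensity fun x => ENNReal.ofReal (p x)

/-- The mass that `μ` puts on `[-x, x]` is at most a constant times `x ^ δ`, as `x → 0`, for some
`δ > 0`. For a spectral measure this is what makes averages over long times decay. -/
def LowFrequencyDecay (μ : Measure ℝ) : Prop :=
  ∃ (δ : ℝ) (A : ℝ≥0), 0 < δ ∧ ∀ x, 0 < x → x ≤ 1 →
    μ (Metric.closedBall 0 x) ≤ A * ENNReal.ofReal (x ^ δ)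

/-- The mass that `μ` puts outside `[-x, x]` is at most a constant times `x ^ (-δ)`, as `x → ∞`, for
some `δ > 0`. For a spectral measure this is a form of smoothness of the process. -/
def HighFrequencyDecay (μ : Measure ℝ) : Prop :=
  ∃ (δ : ℝ) (A : ℝ≥0), 0 < δ ∧ ∀ x, 1 ≤ x →
    μ (Metric.closedBall 0 x)ᶜ ≤ A * ENNReal.ofReal (x ^ (-δ))

variable {p : ℝ → ℝ} {μ : Measure ℝ}

theorem rpow_neg_add_le_of_one_le {x y δ b : ℝ} (hx : 1 ≤ x) (hxy : x ≤ y) (hδ : 0 ≤ δ)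
    (hb : 0 ≤ b) : y ^ (-(δ + b)) ≤ x ^ (-δ) * (2 ^ b * (1 + y) ^ (-b)) := by
  have : 0 < x := by linarith
  have hy0 : 0 < y := by linarith
  calc y ^ (-(δ + b)) = y ^ (-δ) * y ^ (-b) := by rw [neg_add, Real.rpow_add hy0]
    _ ≤ x ^ (-δ) * ((1 + y) / 2) ^ (-b) := by
        refine mul_le_mul ?_ ?_ (by positivity) (by positivity)
        · exact Real.rpow_le_rpow_of_nonpos (by linarith) hxy (by linarith)
        · exact Real.rpow_le_rpow_of_nonpos (by linarith) (by linarith) (by linarith)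
    _ = x ^ (-δ) * (2 ^ b * (1 + y) ^ (-b)) := by
        rw [Real.div_rpow (by linarith) zero_le_two, Real.rpow_neg zero_le_two, div_inv_eq_mul,
          mul_comm (2 ^ b)]

theorem SpectralDecay.highFrequencyDecay (h : SpectralDecay p) :
    HighFrequencyDecay (spectralMeasure p) := by
  obtain ⟨γ, C, hγ, -, hC, hp⟩ := h
  set b : ℝ := 1 + γ / 2
  have htail : ∫⁻ y : ℝ, ENNReal.ofReal ((1 + |y|) ^ (-b)) ≠ ∞ :=
    (lintegral_one_add_abs_rpow_lt_top (by simp only [b]; linarith)).ne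
  lift ∫⁻ y : ℝ, ENNReal.ofReal ((1 + |y|) ^ (-b)) to ℝ≥0 using htail with K hK
  refine ⟨γ / 2, (C * 2 ^ b).toNNReal * K, by positivity, fun x hx => ?_⟩
  have hp_le : ∀ y ∈ (Metric.closedBall 0 x)ᶜ,
      p y ≤ x ^ (-(γ / 2)) * (C * 2 ^ b * (1 + |y|) ^ (-b)) := by
    intro y hy
    have hxy : x < |y| := by simpa using hy
    calc p y ≤ C * |y| ^ (-(γ / 2 + b)) := by
          rw [show γ / 2 + b = 1 + γ by simp only [b]; ring]
          exact hp y (abs_pos.1 (by linarith))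
      _ ≤ C * (x ^ (-(γ / 2)) * (2 ^ b * (1 + |y|) ^ (-b))) := by
          gcongr
          exact rpow_neg_add_le_of_one_le hx hxy.le (by positivity) (by positivity)
      _ = x ^ (-(γ / 2)) * (C * 2 ^ b * (1 + |y|) ^ (-b)) := by ring
  calc spectralMeasure p (Metric.closedBall 0 x)ᶜ
      = ∫⁻ y in (Metric.closedBall 0 x)ᶜ, ENNReal.ofReal (p y) :=
        withDensity_apply _ measurableSet_closedBall.compl
    _ ≤ ∫⁻ y in (Metric.closedBall 0 x)ᶜ,
          ENNReal.ofReal (x ^ (-(γ / 2)) * (C * 2 ^ b * (1 + |y|) ^ (-b))) :=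
        setLIntegral_mono' measurableSet_closedBall.compl fun y hy =>
          ENNReal.ofReal_le_ofReal (hp_le y hy)
    _ ≤ ∫⁻ y, ENNReal.ofReal (x ^ (-(γ / 2)) * (C * 2 ^ b * (1 + |y|) ^ (-b))) :=
        setLIntegral_le_lintegral _ _
    _ = ((C * 2 ^ b).toNNReal * K : ℝ≥0) * ENNReal.ofReal (x ^ (-(γ / 2))) := by
        simp_rw [ENNReal.ofReal_mul (by positivity : (0 : ℝ) ≤ x ^ (-(γ / 2))),
          ENNReal.ofReal_mul (by positivity : (0 : ℝ) ≤ C * 2 ^ b)]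
        rw [lintegral_const_mul' _ _ (by finiteness), lintegral_const_mul' _ _ (by finiteness),
          ← hK, ENNReal.coe_mul, mul_comm]
        rfl

theorem ShortRangeDependence.lowFrequencyDecay (h : ShortRangeDependence p) :
    LowFrequencyDecay (spectralMeasure p) := by
  obtain ⟨⟨M, hM⟩, -⟩ := h
  refine ⟨1, M.toNNReal * 2, one_pos, fun x _ _ => ?_⟩
  calc spectralMeasure p (Metric.closedBall 0 x)
      = ∫⁻ y in Metric.closedBall 0 x, ENNReal.ofReal (p y) :=
        withDensity_apply _ measurableSet_closedBall
    _ ≤ ∫⁻ _ in Metric.closedBall 0 x, ENNReal.ofReal M :=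
        lintegral_mono fun y => ENNReal.ofReal_le_ofReal (hM y)
    _ = (M.toNNReal * 2 : ℝ≥0) * ENNReal.ofReal (x ^ (1 : ℝ)) := by
        rw [setLIntegral_const, Real.volume_closedBall, Real.rpow_one,
          ENNReal.ofReal_mul zero_le_two, ENNReal.coe_mul, mul_assoc, ENNReal.ofReal_ofNat]
        rfl

theorem LowFrequencyDecay.of_measure_closedBall_half_le [IsFiniteMeasure μ] {δ x₀ : ℝ}
    (hδ : 0 < δ) (hx₀ : 0 < x₀) (h : ∀ x ≤ x₀, μ (Metric.closedBall 0 (2⁻¹ * x)) ≤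
      ENNReal.ofReal (2⁻¹ ^ δ) * μ (Metric.closedBall 0 x)) : LowFrequencyDecay μ := by
  have hdyadic (k : ℕ) : μ (Metric.closedBall 0 (2⁻¹ ^ k * x₀)) ≤
      ENNReal.ofReal ((2⁻¹ ^ k) ^ δ) * μ univ := by
    induction k with
    | zero => simpa using measure_mono (subset_univ _)
    | succ k ih =>
      rw [pow_succ', mul_assoc, Real.mul_rpow (by norm_num) (by positivity),
        ENNReal.ofReal_mul (by positivity), mul_assoc]
      exact (h _ (mul_le_of_le_one_left hx₀.le (pow_le_one₀ (by norm_num) (by norm_num)))).trans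
        (by gcongr)
  refine ⟨δ, ((2 / x₀) ^ δ).toNNReal * measureUnivNNReal μ, hδ, fun x hx _ => ?_⟩
  have hconst : ((((2 / x₀) ^ δ).toNNReal * measureUnivNNReal μ : ℝ≥0) : ℝ≥0∞) *
      ENNReal.ofReal (x ^ δ) = ENNReal.ofReal ((2 / x₀ * x) ^ δ) * μ univ := by
    rw [Real.mul_rpow (by positivity) hx.le, ENNReal.ofReal_mul (by positivity), ENNReal.coe_mul,
      coe_measureUnivNNReal, mul_right_comm]
    rfl
  rw [hconst]
  rcases le_or_gt x x₀ with hxx₀ | hxx₀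
  · obtain ⟨k, hk_lt, hk_le⟩ := exists_nat_pow_near_of_lt_one (x := x / x₀) (y := (2⁻¹ : ℝ))
      (by positivity) ((div_le_one hx₀).2 hxx₀) (by norm_num) (by norm_num)
    have hk : (2⁻¹ : ℝ) ^ k ≤ 2 / x₀ * x := by
      rw [pow_succ, lt_div_iff₀ hx₀] at hk_lt
      rw [div_mul_eq_mul_div, le_div_iff₀ hx₀]
      linarith
    calc μ (Metric.closedBall 0 x) ≤ μ (Metric.closedBall 0 (2⁻¹ ^ k * x₀)) :=
          measure_mono (Metric.closedBall_subset_closedBall ((div_le_iff₀ hx₀).1 hk_le))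
      _ ≤ ENNReal.ofReal ((2⁻¹ ^ k) ^ δ) * μ univ := hdyadic k
      _ ≤ ENNReal.ofReal ((2 / x₀ * x) ^ δ) * μ univ := by gcongr
  · refine (measure_mono (subset_univ _)).trans (le_mul_of_one_le_left zero_le ?_)
    rw [ENNReal.one_le_ofReal]
    refine Real.one_le_rpow ?_ hδ.le
    rw [div_mul_eq_mul_div, le_div_iff₀ hx₀]
    linarith

theorem spectralMeasure_closedBall_half_le {ρ x x₀ : ℝ} (hρ : 0 ≤ ρ)
    (h : ∀ y, y ≠ 0 → |y| ≤ x₀ → p (2⁻¹ * y) ≤ ρ * p y) (hx : x ≤ x₀) :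
    spectralMeasure p (Metric.closedBall 0 (2⁻¹ * x)) ≤
      ENNReal.ofReal (2⁻¹ * ρ) * spectralMeasure p (Metric.closedBall 0 x) := by
  set F : ℝ → ℝ → ℝ≥0∞ := fun r => (Metric.closedBall 0 r).indicator fun y => ENNReal.ofReal (p y)
  have hF (r : ℝ) : spectralMeasure p (Metric.closedBall 0 r) = ∫⁻ y, F r y := by
    rw [spectralMeasure, withDensity_apply _ measurableSet_closedBall,
      lintegral_indicator measurableSet_closedBall]
  have hF_half : ∫⁻ y, F (2⁻¹ * x) (2⁻¹ * y) ≤ ENNReal.ofReal ρ * ∫⁻ y, F x y := by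
    rw [← lintegral_const_mul' _ _ ENNReal.ofReal_ne_top]
    refine lintegral_mono_ae ?_
    filter_upwards [compl_mem_ae_iff.2 (measure_singleton (0 : ℝ))] with y hy
    by_cases hyx : y ∈ Metric.closedBall 0 x
    · simp only [F]
      rw [indicator_of_mem hyx, ← ENNReal.ofReal_mul hρ]
      exact (indicator_le_self _ _ _).trans (ENNReal.ofReal_le_ofReal
        (h y hy ((mem_closedBall_zero_iff.1 hyx).trans hx)))
    · have hyx' : 2⁻¹ * y ∉ Metric.closedBall 0 (2⁻¹ * x) := by
        simpa [abs_mul] using hyx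
      simp [F, indicator_of_notMem hyx']
  rw [lintegral_comp_mul_left _ (by norm_num : (2⁻¹ : ℝ) ≠ 0)] at hF_half
  calc spectralMeasure p (Metric.closedBall 0 (2⁻¹ * x))
      = ENNReal.ofReal 2⁻¹ * (ENNReal.ofReal |(2⁻¹ : ℝ)⁻¹| * ∫⁻ y, F (2⁻¹ * x) y) := by
        rw [hF, ← mul_assoc, ← ENNReal.ofReal_mul (by norm_num)]
        norm_num
    _ ≤ ENNReal.ofReal 2⁻¹ * (ENNReal.ofReal ρ * ∫⁻ y, F x y) := by gcongr
    _ = ENNReal.ofReal (2⁻¹ * ρ) * spectralMeasure p (Metric.closedBall 0 x) := by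
        rw [hF, ENNReal.ofReal_mul (by norm_num), mul_assoc]

theorem LongRangeDependence.exists_half_le (h : LongRangeDependence p) :
    ∃ δ x₀ : ℝ, 0 < δ ∧ 0 < x₀ ∧
      ∀ x, x ≠ 0 → |x| ≤ x₀ → p (2⁻¹ * x) ≤ 2 ^ (1 - δ) * p x := by
  obtain ⟨H, L, hH, -, hL, hp⟩ := h
  obtain ⟨x₁, hx₁, hp⟩ := Metric.eventually_nhds_iff.1 (eventually_nhdsWithin_iff.1 hp)
  obtain ⟨r₀, hr₀⟩ := eventually_atTop.1 ((hL.slowly 2 two_pos).eventually_le_const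
    (Real.one_lt_rpow one_lt_two (by positivity : 0 < H / 2)))
  set r := max r₀ 1
  have : 1 ≤ r := le_max_right _ _
  refine ⟨H / 2, min (x₁ / 2) r⁻¹, by positivity, by positivity, fun x hx0 hx => ?_⟩
  have hxa : 0 < |x| := abs_pos.2 hx0
  have hxx₁ : |x| ≤ x₁ / 2 := hx.trans (min_le_left _ _)
  have hxr : r ≤ |x|⁻¹ := le_inv_of_le_inv₀ (by positivity) (hx.trans (min_le_right _ _))
  have habs : |2⁻¹ * x| = 2⁻¹ * |x| := by rw [abs_mul, abs_of_pos (by norm_num)]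
  have hL_double : L (2 * |x|⁻¹) ≤ 2 ^ (H / 2) * L |x|⁻¹ :=
    (div_le_iff₀ (hL.pos _ (by positivity))).1 (hr₀ _ ((le_max_left _ _).trans hxr))
  have hpx : p x = L |x|⁻¹ * |x| ^ (H - 1) :=
    hp (by rw [dist_zero_right, Real.norm_eq_abs]; linarith) hx0
  have hp_half : p (2⁻¹ * x) = L (2 * |x|⁻¹) * (2⁻¹ ^ (H - 1) * |x| ^ (H - 1)) := by
    rw [hp (by rw [dist_zero_right, Real.norm_eq_abs, habs]; linarith) (by simpa using hx0), habs,
      mul_inv, inv_inv, Real.mul_rpow (by norm_num) hxa.le]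
  calc p (2⁻¹ * x) ≤ 2 ^ (H / 2) * L |x|⁻¹ * (2⁻¹ ^ (H - 1) * |x| ^ (H - 1)) := by
        rw [hp_half]
        gcongr
    _ = 2 ^ (1 - H / 2) * p x := by
        rw [hpx, Real.inv_rpow zero_le_two, ← Real.rpow_neg zero_le_two,
          show 1 - H / 2 = H / 2 + -(H - 1) by ring, Real.rpow_add two_pos]
        ring

theorem isFiniteMeasure_spectralMeasure (hp : Integrable p) : IsFiniteMeasure (spectralMeasure p) :=
  isFiniteMeasure_withDensity_ofReal hp.2

theorem LongRangeDependence.lowFrequencyDecay (h : LongRangeDependence p) (hp : Integrable p) :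
    LowFrequencyDecay (spectralMeasure p) := by
  have := isFiniteMeasure_spectralMeasure hp
  obtain ⟨δ, x₀, hδ, hx₀, hhalf⟩ := h.exists_half_le
  refine LowFrequencyDecay.of_measure_closedBall_half_le hδ hx₀ fun x hx => ?_
  refine (spectralMeasure_closedBall_half_le (by positivity) hhalf hx).trans_eq ?_
  rw [Real.rpow_sub two_pos, Real.rpow_one, Real.inv_rpow zero_le_two]
  congr 2
  field_simp

end SpectralMeasure

section ScaleVariance

variable {μ : Measure ℝ} {ψ : ℝ → ℂ} {C : ℝ}

theorem lintegral_enorm_sq_le_of_norm_le_of_norm_le {f : ℝ → ℂ} {S : Set ℝ} (hS : MeasurableSet S)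
    {M₁ M₂ : ℝ} (h₁ : ∀ x ∈ S, ‖f x‖ ≤ M₁) (h₂ : ∀ x ∈ Sᶜ, ‖f x‖ ≤ M₂) :
    ∫⁻ x, ‖f x‖ₑ ^ 2 ∂μ ≤ ENNReal.ofReal (M₁ ^ 2) * μ S + ENNReal.ofReal (M₂ ^ 2) * μ Sᶜ := by
  have hpart {A : Set ℝ} (hA : MeasurableSet A) {M : ℝ} (h : ∀ x ∈ A, ‖f x‖ ≤ M) :
      ∫⁻ x in A, ‖f x‖ₑ ^ 2 ∂μ ≤ ENNReal.ofReal (M ^ 2) * μ A := by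
    rw [← setLIntegral_const]
    refine setLIntegral_mono' hA fun x hx => ?_
    rw [← ofReal_norm, ← ENNReal.ofReal_pow (norm_nonneg _)]
    gcongr
    exact h x hx
  rw [← lintegral_add_compl _ hS]
  exact add_le_add (hpart hS h₁) (hpart hS.compl h₂)

theorem exists_le_mul_rpow_neg_of_le_add {F : ℝ → ℝ≥0∞} {C δ : ℝ} {T A : ℝ≥0} (hδ : 0 < δ)
    (h : ∀ u, 1 ≤ u → F u ≤ ENNReal.ofReal ((C * u ^ (-(1 / 2) : ℝ)) ^ 2) * T +
      ENNReal.ofReal (C ^ 2) * (A * ENNReal.ofReal (u ^ (-(δ / 2))))) :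
    ∃ (ε : ℝ) (B : ℝ≥0), 0 < ε ∧ ∀ u, 1 ≤ u → F u ≤ B * ENNReal.ofReal (u ^ (-ε)) := by
  set ε := min 1 (δ / 2)
  refine ⟨ε, (C ^ 2).toNNReal * (T + A), by positivity, fun u hu => (h u hu).trans ?_⟩
  have hu0 : 0 < u := by linarith
  calc ENNReal.ofReal ((C * u ^ (-(1 / 2) : ℝ)) ^ 2) * T +
        ENNReal.ofReal (C ^ 2) * (A * ENNReal.ofReal (u ^ (-(δ / 2))))
      = ENNReal.ofReal (C ^ 2) * (T * ENNReal.ofReal (u ^ (-1 : ℝ)) +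
          A * ENNReal.ofReal (u ^ (-(δ / 2)))) := by
        rw [mul_pow, ← Real.rpow_mul_natCast hu0.le, ENNReal.ofReal_mul (sq_nonneg C)]
        norm_num
        ring
    _ ≤ ENNReal.ofReal (C ^ 2) * (T * ENNReal.ofReal (u ^ (-ε)) +
          A * ENNReal.ofReal (u ^ (-ε))) := by
        gcongr
        · exact min_le_left _ _
        · exact min_le_right _ _
    _ = ((C ^ 2).toNNReal * (T + A) : ℝ≥0) * ENNReal.ofReal (u ^ (-ε)) := by
        rw [← add_mul, ← mul_assoc, ENNReal.coe_mul, ENNReal.coe_add]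
        rfl

theorem IsRegularWavelet.exists_lintegral_contract_sq_le [IsFiniteMeasure μ]
    (hψ : IsRegularWavelet ψ C) (hμ : HighFrequencyDecay μ) :
    ∃ (ε : ℝ) (B : ℝ≥0), 0 < ε ∧ ∀ u, 1 ≤ u →
      ∫⁻ x, ‖fourierHat ψ (u⁻¹ * x)‖ₑ ^ 2 ∂μ ≤ B * ENNReal.ofReal (u ^ (-ε)) := by
  obtain ⟨δ, A, hδ, hμ⟩ := hμ
  have hC := hψ.const_nonneg
  refine exists_le_mul_rpow_neg_of_le_add (C := C) (T := measureUnivNNReal μ) (A := A) hδ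
    fun u hu => ?_
  have hu0 : 0 < u := by linarith
  refine (lintegral_enorm_sq_le_of_norm_le_of_norm_le
    (measurableSet_closedBall (x := (0 : ℝ)) (ε := u ^ (1 / 2 : ℝ)))
    (M₁ := C * u ^ (-(1 / 2) : ℝ)) (fun x hx => ?_)
    fun x _ => hψ.norm_fourierHat_le_const _).trans ?_
  · calc ‖fourierHat ψ (u⁻¹ * x)‖ ≤ C * |u⁻¹ * x| := hψ.norm_fourierHat_le_const_mul_abs _
      _ ≤ C * (u ^ (-1 : ℝ) * u ^ (1 / 2 : ℝ)) := by
          rw [abs_mul, abs_of_pos (inv_pos.2 hu0), Real.rpow_neg_one]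
          gcongr
          exact mem_closedBall_zero_iff.1 hx
      _ = C * u ^ (-(1 / 2) : ℝ) := by
          rw [← Real.rpow_add hu0]
          norm_num
  · gcongr
    · exact (measure_mono (subset_univ _)).trans_eq (coe_measureUnivNNReal μ).symm
    · refine (hμ _ (Real.one_le_rpow hu (by norm_num))).trans_eq ?_
      rw [← Real.rpow_mul hu0.le]
      ring_nf

theorem IsRegularWavelet.exists_lintegral_dilate_sq_le [IsFiniteMeasure μ]
    (hψ : IsRegularWavelet ψ C) (hμ : LowFrequencyDecay μ) :
    ∃ (ε : ℝ) (B : ℝ≥0), 0 < ε ∧ ∀ u, 1 ≤ u →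
      ∫⁻ x, ‖fourierHat ψ (u * x)‖ₑ ^ 2 ∂μ ≤ B * ENNReal.ofReal (u ^ (-ε)) := by
  obtain ⟨δ, A, hδ, hμ⟩ := hμ
  have hC := hψ.const_nonneg
  refine exists_le_mul_rpow_neg_of_le_add (C := C) (T := measureUnivNNReal μ) (A := A) hδ
    fun u hu => ?_
  have hu0 : 0 < u := by linarith
  refine (lintegral_enorm_sq_le_of_norm_le_of_norm_le
    (measurableSet_closedBall (x := (0 : ℝ)) (ε := u ^ (-(1 / 2) : ℝ))).compl
    (M₁ := C * u ^ (-(1 / 2) : ℝ)) (fun x hx => ?_)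
    fun x _ => hψ.norm_fourierHat_le_const _).trans ?_
  · have hx : u ^ (-(1 / 2) : ℝ) < |x| := by simpa using hx
    calc ‖fourierHat ψ (u * x)‖ ≤ C / (1 + |u * x|) := hψ.decay _
      _ ≤ C / (u ^ (1 : ℝ) * u ^ (-(1 / 2) : ℝ)) := by
          rw [abs_mul, abs_of_pos hu0, Real.rpow_one]
          gcongr
          nlinarith
      _ = C * u ^ (-(1 / 2) : ℝ) := by
          rw [← Real.rpow_add hu0, div_eq_mul_inv, ← Real.rpow_neg hu0.le]
          norm_num
  · rw [compl_compl]
    gcongr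
    · exact (measure_mono (subset_univ _)).trans_eq (coe_measureUnivNNReal μ).symm
    · refine (hμ _ (by positivity)
        (Real.rpow_le_one_of_one_le_of_nonpos hu (by norm_num))).trans_eq ?_
      rw [← Real.rpow_mul hu0.le]
      ring_nf

theorem lintegral_fourierHat_waveletAtom_sq {p : ℝ → ℝ} (hψ : Integrable ψ) (hp : Integrable p)
    {a : ℝ × ℝ} (ha : 0 < a.2) :
    ∫⁻ x, ‖fourierHat (waveletAtom ψ a) x‖ₑ ^ 2 * ENNReal.ofReal (p x) =
      ∫⁻ x, ‖fourierHat ψ (a.2 * x)‖ₑ ^ 2 ∂spectralMeasure p := by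
  have hmeas : Measurable fun x => ‖fourierHat ψ (a.2 * x)‖ₑ ^ 2 :=
    ((continuous_fourierHat hψ).comp (continuous_const_mul _)).measurable.enorm.pow_const 2
  rw [spectralMeasure, lintegral_withDensity_eq_lintegral_mul₀ hp.aemeasurable.ennreal_ofReal
    hmeas.aemeasurable]
  refine lintegral_congr fun x => ?_
  rw [fourierHat_waveletAtom _ ha, enorm_mul, ← ofReal_norm (Complex.exp _), norm_exp_neg_I_mul,
    ENNReal.ofReal_one, one_mul, Pi.mul_apply, mul_comm]

end ScaleVariance

section Chaining

variable {E : Type*} [NormedAddCommGroup E]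

/-- The times in `[-(n + 1), n + 1]` with the parameters in `[n + 1, n + 2]`. Every half-line
`{t} × [u₀, ∞)` is eventually covered by these strips. -/
def parameterStrip (n : ℕ) : Set (ℝ × ℝ) :=
  Icc (-(n + 1) : ℝ) (n + 1) ×ˢ Icc (n + 1 : ℝ) (n + 2)

/-- On `[-N, N] × [1, N]` the function `y` has a Hölder modulus of continuity with exponent `β / 2`
and with a constant that grows at most like `N ^ (κ / 2)`. -/
def HasPolynomialModulus (y : ℝ × ℝ → E) (κ : ℕ) (β : ℝ) : Prop :=
  ∃ M : ℝ≥0∞, M ≠ ∞ ∧ ∀ N : ℝ, 1 ≤ N → ∀ a ∈ Icc (-N) N ×ˢ Icc 1 N, ∀ b ∈ Icc (-N) N ×ˢ Icc 1 N,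
    ‖y a - y b‖ₑ ^ 2 ≤ M * ENNReal.ofReal (N ^ κ * dist a b ^ β)

theorem exists_finset_Icc_dist_le (x : ℝ) (l : ℕ) {k : ℕ} (hk : k ≠ 0) :
    ∃ S : Finset ℝ, (S : Set ℝ) ⊆ Icc x (x + l) ∧ S.card ≤ l * k + 1 ∧
      ∀ y ∈ Icc x (x + l), ∃ z ∈ S, dist y z ≤ (k : ℝ)⁻¹ := by
  have hk0 : (0 : ℝ) < k := by positivity
  refine ⟨(Finset.range (l * k + 1)).image fun i : ℕ => x + i / k, ?_,
    Finset.card_image_le.trans_eq (Finset.card_range _), fun y hy => ?_⟩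
  · rw [Finset.coe_image, image_subset_iff]
    intro i hi
    have hik : (i : ℝ) ≤ l * k := by
      exact_mod_cast Nat.lt_succ_iff.1 (Finset.mem_range.1 (Finset.mem_coe.1 hi))
    exact ⟨le_add_of_nonneg_right (by positivity),
      add_le_add_right ((div_le_iff₀ hk0).2 hik) x⟩
  · have hyk : 0 ≤ (y - x) * k := mul_nonneg (by linarith [hy.1]) hk0.le
    have hyl : (y - x) * k ≤ (l * k : ℕ) := by
      push_cast
      gcongr
      linarith [hy.2]
    refine ⟨x + ⌊(y - x) * k⌋₊ / k, Finset.mem_image_of_mem _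
      (Finset.mem_range.2 (Nat.lt_succ_of_le (Nat.floor_le_of_le hyl))), ?_⟩
    have hlow : (⌊(y - x) * k⌋₊ : ℝ) / k ≤ y - x := (div_le_iff₀ hk0).2 (Nat.floor_le hyk)
    have hhigh : y - x ≤ (⌊(y - x) * k⌋₊ : ℝ) / k + (k : ℝ)⁻¹ := by
      rw [inv_eq_one_div, ← add_div, le_div_iff₀ hk0]
      exact (Nat.lt_floor_add_one _).le
    rw [Real.dist_eq, abs_le]
    constructor <;> linarith [inv_pos.2 hk0]

theorem exists_finset_parameterStrip_dist_le (m n : ℕ) :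
    ∃ S : Finset (ℝ × ℝ), (S : Set (ℝ × ℝ)) ⊆ parameterStrip n ∧
      S.card ≤ 6 * (n + 1) ^ (2 * m + 1) ∧
      ∀ a ∈ parameterStrip n, ∃ b ∈ S, dist a b ≤ ((n + 1 : ℝ) ^ m)⁻¹ := by
  have hk : (n + 1) ^ m ≠ 0 := by positivity
  obtain ⟨S, hS, hS_card, hS_dist⟩ := exists_finset_Icc_dist_le (-(n + 1)) (2 * (n + 1)) hk
  obtain ⟨T, hT, hT_card, hT_dist⟩ := exists_finset_Icc_dist_le (n + 1) 1 hk
  have hS_end : -(n + 1 : ℝ) + (2 * (n + 1) : ℕ) = n + 1 := by push_cast; ring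
  have hT_end : (n + 1 : ℝ) + (1 : ℕ) = n + 2 := by push_cast; ring
  rw [hS_end] at hS hS_dist
  rw [hT_end] at hT hT_dist
  push_cast at hS_dist hT_dist
  refine ⟨S ×ˢ T, ?_, ?_, fun a ha => ?_⟩
  · rw [Finset.coe_product]
    exact prod_mono hS hT
  · have hpow : 1 ≤ (n + 1) ^ m := Nat.one_le_iff_ne_zero.2 hk
    calc (S ×ˢ T).card ≤ (2 * (n + 1) * (n + 1) ^ m + 1) * (1 * (n + 1) ^ m + 1) := by
          rw [Finset.card_product]
          gcongr
      _ ≤ (2 * (n + 1) * (n + 1) ^ m + (n + 1) * (n + 1) ^ m) *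
            (1 * (n + 1) ^ m + (n + 1) ^ m) := by
          gcongr
          exact hpow.trans (Nat.le_mul_of_pos_left _ n.succ_pos)
      _ = 6 * (n + 1) ^ (2 * m + 1) := by ring
  · obtain ⟨b, hb, hab⟩ := hS_dist a.1 ha.1
    obtain ⟨c, hc, hac⟩ := hT_dist a.2 ha.2
    exact ⟨(b, c), Finset.mk_mem_product hb hc, max_le hab hac⟩

theorem parameterStrip_subset (n : ℕ) :
    parameterStrip n ⊆ Icc (-(n + 2) : ℝ) (n + 2) ×ˢ Icc (1 : ℝ) (n + 2) :=
  prod_mono (Icc_subset_Icc (by linarith) (by linarith))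
    (Icc_subset_Icc_left (by linarith [(Nat.cast_nonneg n : (0 : ℝ) ≤ n)]))

theorem add_one_pow_mul_rpow_le {x β : ℝ} {κ m : ℕ} (hx : 1 ≤ x) (hm : κ + 1 ≤ m * β) :
    (x + 1) ^ κ * ((x ^ m)⁻¹) ^ β ≤ 2 ^ κ / x := by
  have hx0 : 0 < x := by linarith
  calc (x + 1) ^ κ * ((x ^ m)⁻¹) ^ β ≤ (2 * x) ^ κ * x ^ (-(κ + 1 : ℝ)) := by
        rw [Real.inv_rpow (by positivity), ← Real.rpow_natCast_mul hx0.le, ← Real.rpow_neg hx0.le]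
        gcongr
        linarith
    _ = 2 ^ κ / x := by
        rw [mul_pow, neg_add, Real.rpow_add hx0, Real.rpow_neg hx0.le, Real.rpow_natCast,
          Real.rpow_neg_one]
        field_simp

theorem tendsto_const_mul_ofReal_div_add_one {M : ℝ≥0∞} (hM : M ≠ ∞) (c : ℝ) :
    Tendsto (fun n : ℕ => M * ENNReal.ofReal (c / (n + 1))) atTop (𝓝 0) := by
  have h : Tendsto (fun n : ℕ => c / (n + 1 : ℝ)) atTop (𝓝 0) :=
    tendsto_const_nhds.div_atTop (tendsto_atTop_add_const_right _ _ tendsto_natCast_atTop_atTop)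
  simpa using ENNReal.Tendsto.const_mul (ENNReal.tendsto_ofReal h) (Or.inr hM)

theorem tendsto_rpow_const_zero {ι : Type*} {l : Filter ι} {f : ι → ℝ≥0∞} {r : ℝ} (hr : 0 < r)
    (hf : Tendsto f l (𝓝 0)) : Tendsto (fun i => f i ^ r) l (𝓝 0) := by
  simpa [ENNReal.zero_rpow_of_pos hr] using hf.ennrpow_const r

theorem HasPolynomialModulus.tendsto_zero {y : ℝ × ℝ → E} {κ m : ℕ} {β : ℝ}
    (hy : HasPolynomialModulus y κ β) (hβ : 0 ≤ β) (hm : κ + 1 ≤ m * β)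
    {S : ℕ → Finset (ℝ × ℝ)} (hS : ∀ n, (S n : Set (ℝ × ℝ)) ⊆ parameterStrip n)
    (hS_dist : ∀ n, ∀ a ∈ parameterStrip n, ∃ b ∈ S n, dist a b ≤ ((n + 1 : ℝ) ^ m)⁻¹)
    (hlim : Tendsto (fun n => (S n).sup fun a => ‖y a‖ₑ) atTop (𝓝 0)) (t : ℝ) :
    Tendsto (fun u => y (t, u)) atTop (𝓝 0) := by
  obtain ⟨M, hM, hmod⟩ := hy
  set err : ℕ → ℝ≥0∞ := fun n => (M * ENNReal.ofReal (2 ^ κ / (n + 1))) ^ (2⁻¹ : ℝ)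
  have hle (n : ℕ) (a : ℝ × ℝ) (ha : a ∈ parameterStrip n) :
      ‖y a‖ₑ ≤ ((S n).sup fun b => ‖y b‖ₑ) + err n := by
    have : (0 : ℝ) ≤ n := n.cast_nonneg
    obtain ⟨b, hb, hab⟩ := hS_dist n a ha
    have hsub : ‖y a - y b‖ₑ ≤ err n := by
      rw [ENNReal.le_rpow_inv_iff two_pos, ENNReal.rpow_two]
      refine (hmod (n + 2) (by linarith) a (parameterStrip_subset n ha) b
        (parameterStrip_subset n (hS n hb))).trans ?_
      gcongr
      calc (n + 2 : ℝ) ^ κ * dist a b ^ β ≤ (n + 1 + 1 : ℝ) ^ κ * (((n + 1 : ℝ) ^ m)⁻¹) ^ β := by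
            rw [add_assoc, one_add_one_eq_two]
            gcongr
        _ ≤ 2 ^ κ / (n + 1) := add_one_pow_mul_rpow_le (by linarith) hm
    calc ‖y a‖ₑ = ‖y b + (y a - y b)‖ₑ := by rw [add_sub_cancel]
      _ ≤ ‖y b‖ₑ + ‖y a - y b‖ₑ := enorm_add_le _ _
      _ ≤ _ := add_le_add (Finset.le_sup (f := fun b => ‖y b‖ₑ) hb) hsub
  have hbound : Tendsto (fun n => ((S n).sup fun b => ‖y b‖ₑ) + err n) atTop (𝓝 0) := by
    simpa using hlim.add (tendsto_rpow_const_zero (inv_pos.2 two_pos)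
      (tendsto_const_mul_ofReal_div_add_one hM (2 ^ κ)))
  have hfloor : Tendsto (fun u : ℝ => ⌊u - 1⌋₊) atTop atTop :=
    tendsto_nat_floor_atTop.comp (tendsto_atTop_add_const_right _ (-1) tendsto_id)
  rw [tendsto_zero_iff_enorm_tendsto_zero]
  refine tendsto_of_tendsto_of_tendsto_of_le_of_le' tendsto_const_nhds (hbound.comp hfloor)
    (Eventually.of_forall fun _ => zero_le) ?_
  filter_upwards [eventually_ge_atTop 1, eventually_ge_atTop (|t| + 1)] with u hu htu
  refine hle ⌊u - 1⌋₊ (t, u) ⟨abs_le.1 ?_, ?_, ?_⟩ <;> dsimp only <;>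
    linarith [Nat.floor_le (sub_nonneg.2 hu), Nat.lt_floor_add_one (u - 1)]

variable {Ω : Type*} [MeasurableSpace Ω] {P : Measure Ω}

theorem ae_tendsto_sup_of_tsum_lintegral_pow_ne_top {ι : Type*} {S : ℕ → Finset ι}
    {Y : ι → Ω → ℝ≥0∞} {q : ℕ} (hq : q ≠ 0) (hY : ∀ n, ∀ a ∈ S n, AEMeasurable (Y a) P)
    (h : ∑' n, ∑ a ∈ S n, ∫⁻ ω, Y a ω ^ q ∂P ≠ ∞) :
    ∀ᵐ ω ∂P, Tendsto (fun n => (S n).sup fun a => Y a ω) atTop (𝓝 0) := by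
  have hmeas (n : ℕ) : AEMeasurable (fun ω => ∑ a ∈ S n, Y a ω ^ q) P :=
    Finset.aemeasurable_fun_sum _ fun a ha => (hY n a ha).pow_const q
  have hsum : ∫⁻ ω, ∑' n, ∑ a ∈ S n, Y a ω ^ q ∂P ≠ ∞ := by
    rw [lintegral_tsum hmeas]
    simp_rw [fun n => lintegral_finsetSum' (S n) fun a ha => (hY n a ha).pow_const q]
    exact h
  filter_upwards [ae_lt_top' (AEMeasurable.tsum hmeas) hsum] with ω hω
  refine tendsto_of_tendsto_of_tendsto_of_le_of_le tendsto_const_nhds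
    (tendsto_rpow_const_zero (r := (q : ℝ)⁻¹) (by positivity)
      (ENNReal.tendsto_atTop_zero_of_tsum_ne_top hω.ne))
    (fun _ => zero_le) fun n => Finset.sup_le fun a ha => ?_
  rw [ENNReal.le_rpow_inv_iff (by positivity), ENNReal.rpow_natCast]
  exact Finset.single_le_sum (f := fun a => Y a ω ^ q) (fun _ _ => zero_le) ha

theorem tsum_sum_ne_top_of_card_le {ι : Type*} {S : ℕ → Finset ι} {F : ι → ℝ≥0∞} {c r : ℕ}
    {K : ℝ≥0∞} (hK : K ≠ ∞) (hS : ∀ n, (S n).card ≤ c * (n + 1) ^ r)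
    (hF : ∀ n, ∀ a ∈ S n, F a ≤ K * ENNReal.ofReal (((n + 1 : ℝ) ^ (r + 2))⁻¹)) :
    ∑' n, ∑ a ∈ S n, F a ≠ ∞ := by
  have hle (n : ℕ) : ∑ a ∈ S n, F a ≤ K * ENNReal.ofReal (c * (1 / ((n + 1 : ℕ) : ℝ) ^ 2)) := by
    calc ∑ a ∈ S n, F a ≤ (S n).card • (K * ENNReal.ofReal (((n + 1 : ℝ) ^ (r + 2))⁻¹)) :=
          Finset.sum_le_card_nsmul _ _ _ (hF n)
      _ ≤ (c * (n + 1) ^ r : ℕ) • (K * ENNReal.ofReal (((n + 1 : ℝ) ^ (r + 2))⁻¹)) := by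
          gcongr
          exact hS n
      _ = K * ENNReal.ofReal (c * (1 / ((n + 1 : ℕ) : ℝ) ^ 2)) := by
          rw [nsmul_eq_mul, mul_left_comm, ← ENNReal.ofReal_natCast,
            ← ENNReal.ofReal_mul (by positivity)]
          push_cast
          congr 2
          field_simp
          ring
  refine ne_top_of_le_ne_top ?_ (ENNReal.tsum_le_tsum hle)
  rw [ENNReal.tsum_mul_left]
  refine ENNReal.mul_ne_top hK (Summable.tsum_ofReal_ne_top (Summable.mul_left _ ?_))
  exact (summable_nat_add_iff 1).2 (Real.summable_one_div_nat_pow.2 one_lt_two)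

theorem ae_tendsto_zero_of_hasPolynomialModulus {Y : ℝ × ℝ → Ω → E} {δ β : ℝ} {κ : ℕ} (hδ : 0 < δ)
    (hβ : 0 < β) (hmeas : ∀ a : ℝ × ℝ, 1 ≤ a.2 → AEMeasurable (fun ω => ‖Y a ω‖ₑ) P)
    (hmoment : ∀ k : ℕ, k ≠ 0 → ∃ K : ℝ≥0∞, K ≠ ∞ ∧ ∀ a : ℝ × ℝ, 1 ≤ a.2 →
      ∫⁻ ω, ‖Y a ω‖ₑ ^ (2 * k) ∂P ≤ K * ENNReal.ofReal (a.2 ^ (-δ)) ^ k)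
    (hmod : ∀ᵐ ω ∂P, HasPolynomialModulus (fun a => Y a ω) κ β) :
    ∀ᵐ ω ∂P, ∀ t, Tendsto (fun u => Y (t, u) ω) atTop (𝓝 0) := by
  obtain ⟨m, hm⟩ := exists_nat_ge ((κ + 1) / β)
  rw [div_le_iff₀ hβ] at hm
  choose S hS hS_card hS_dist using exists_finset_parameterStrip_dist_le m
  obtain ⟨k, hk⟩ := exists_nat_ge ((2 * m + 1 + 2 : ℕ) / δ)
  rw [div_le_iff₀ hδ] at hk
  have hk0 : k ≠ 0 := by
    rintro rfl
    rw [Nat.cast_zero, zero_mul, Nat.cast_nonpos] at hk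
    omega
  obtain ⟨K, hK, hmoment⟩ := hmoment k hk0
  have hS_one {n : ℕ} {a : ℝ × ℝ} (ha : a ∈ S n) : 1 ≤ a.2 :=
    (parameterStrip_subset n (hS n ha)).2.1
  have hmoment_le (n : ℕ) (a : ℝ × ℝ) (ha : a ∈ S n) : ∫⁻ ω, ‖Y a ω‖ₑ ^ (2 * k) ∂P ≤
      K * ENNReal.ofReal (((n + 1 : ℝ) ^ (2 * m + 1 + 2))⁻¹) := by
    refine (hmoment a (hS_one ha)).trans ?_
    have ha0 : 0 < a.2 := one_pos.trans_le (hS_one ha)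
    gcongr
    rw [← ENNReal.ofReal_pow (by positivity), ← Real.rpow_mul_natCast ha0.le]
    refine ENNReal.ofReal_le_ofReal ?_
    calc a.2 ^ (-δ * k) ≤ a.2 ^ (-(2 * m + 1 + 2 : ℕ) : ℝ) :=
          Real.rpow_le_rpow_of_exponent_le (hS_one ha) (by linarith)
      _ = (a.2 ^ (2 * m + 1 + 2))⁻¹ := by rw [Real.rpow_neg ha0.le, Real.rpow_natCast]
      _ ≤ ((n + 1 : ℝ) ^ (2 * m + 1 + 2))⁻¹ := by
          gcongr
          exact (hS n ha).2.1
  have hlim := ae_tendsto_sup_of_tsum_lintegral_pow_ne_top (Y := fun a ω => ‖Y a ω‖ₑ)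
    (mul_ne_zero two_ne_zero hk0) (fun n a ha => hmeas a (hS_one ha))
    (tsum_sum_ne_top_of_card_le hK hS_card hmoment_le)
  filter_upwards [hlim, hmod] with ω hω hmod t
  exact hmod.tendsto_zero hβ.le hm hS hS_dist hω t

end Chaining

section Paths

variable {ψ : ℝ → ℂ} {C : ℝ} {x g : ℝ → ℂ}

theorem lintegral_inv_weight_rpow_lt_top {r : ℝ} (hr : 1 < r) : ∫⁻ τ, (weight τ ^ r)⁻¹ < ∞ := by
  refine lt_of_eq_of_lt (lintegral_congr fun τ => ?_) (lintegral_one_add_abs_rpow_lt_top hr)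
  have hτ : 0 < 1 + |τ| := by positivity
  rw [weight_eq_ofReal, ENNReal.ofReal_rpow_of_pos hτ, ← ENNReal.ofReal_inv_of_pos (by positivity),
    Real.rpow_neg hτ.le]

theorem sq_lintegral_enorm_mul_conj_le (r : ℝ) (hx : AEStronglyMeasurable x)
    (hg : AEStronglyMeasurable g) : (∫⁻ τ, ‖x τ * (starRingEnd ℂ) (g τ)‖ₑ) ^ 2 ≤
      (∫⁻ τ, (weight τ ^ r)⁻¹ * ‖x τ‖ₑ ^ 2) * ∫⁻ τ, weight τ ^ r * ‖g τ‖ₑ ^ 2 := by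
  simp_rw [enorm_mul, RCLike.enorm_conj]
  exact sq_lintegral_mul_le (measurable_weight.pow_const r).aemeasurable hx.enorm hg.enorm
    (fun τ => (ENNReal.rpow_pos (pos_iff_ne_zero.2 (weight_ne_zero τ)) (weight_ne_top τ)).ne')
    fun τ => ENNReal.rpow_ne_top_of_ne_zero (weight_ne_zero τ) (weight_ne_top τ)

theorem exists_mem_timeScaleBox {a : ℝ × ℝ} (ha : 0 < a.2) : ∃ N, 1 ≤ N ∧ a ∈ timeScaleBox N :=
  ⟨max 1 (max |a.1| (max a.2⁻¹ a.2)), le_max_left _ _, by simp,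
    inv_le_of_inv_le₀ ha (by simp), by simp⟩

theorem IsRegularWavelet.integrable_mul_conj_waveletAtom (hψ : IsRegularWavelet ψ C)
    (hx : AEStronglyMeasurable x)
    (hx_int : ∫⁻ τ, (weight τ ^ (3 / 2 : ℝ))⁻¹ * ‖x τ‖ₑ ^ 2 < ∞) {a : ℝ × ℝ} (ha : 0 < a.2) :
    Integrable fun τ => x τ * (starRingEnd ℂ) (waveletAtom ψ a τ) := by
  obtain ⟨N, hN, haN⟩ := exists_mem_timeScaleBox ha
  have hatom := (integrable_waveletAtom hψ.integrable ha).aestronglyMeasurable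
  have hatom_two : ∫⁻ τ, ‖waveletAtom ψ a τ‖ₑ ^ 2 < ∞ := by
    rw [lintegral_enorm_sq]
    exact ENNReal.pow_lt_top (memLp_waveletAtom hψ.integrable hψ.memLp_two ha).2
  have hatom_weight : ∫⁻ τ, weight τ ^ 2 * ‖waveletAtom ψ a τ‖ₑ ^ 2 < ∞ :=
    (lintegral_weight_sq_mul_waveletAtom_sq_le ψ hN haN).trans_lt
      (ENNReal.mul_lt_top ENNReal.ofReal_lt_top hψ.lintegral_weight_sq_lt_top)
  refine ⟨hx.mul (Complex.continuous_conj.comp_aestronglyMeasurable hatom), ?_⟩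
  refine (ENNReal.pow_lt_top_iff.1 ((sq_lintegral_enorm_mul_conj_le (3 / 2) hx hatom).trans_lt
    (ENNReal.mul_lt_top hx_int ?_))).resolve_right two_ne_zero
  exact (lintegral_weight_rpow_mul_sq_le hatom).trans_lt (by finiteness)

/-- Weighted Cauchy–Schwarz transfers the modulus of continuity of the atoms to the transform. -/
theorem IsRegularWavelet.hasPolynomialModulus_integral_mul_conj (hψ : IsRegularWavelet ψ C)
    (hx : AEStronglyMeasurable x)
    (hx_int : ∫⁻ τ, (weight τ ^ (3 / 2 : ℝ))⁻¹ * ‖x τ‖ₑ ^ 2 < ∞) {σ : ℝ → ℝ}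
    (hσ : ∀ N, ∀ u ∈ Icc 1 N, σ u ∈ Icc N⁻¹ N) (hσ_lip : LipschitzOnWith 1 σ (Ici 1)) :
    HasPolynomialModulus
      (fun a => ∫ τ, x τ * (starRingEnd ℂ) (waveletAtom ψ (a.1, σ a.2) τ)) 3 (1 / 8) := by
  obtain ⟨K, hK, hmodulus⟩ := hψ.exists_lintegral_weight_mul_waveletAtom_sub_sq_le
  refine ⟨_, ENNReal.mul_ne_top hx_int.ne hK, fun N hN a ha b hb => ?_⟩
  have hbox {c : ℝ × ℝ} (hc : c ∈ Icc (-N) N ×ˢ Icc 1 N) : (c.1, σ c.2) ∈ timeScaleBox N :=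
    ⟨abs_le.2 hc.1, hσ N c.2 hc.2⟩
  have hpos {c : ℝ × ℝ} (hc : c ∈ Icc (-N) N ×ˢ Icc 1 N) : 0 < σ c.2 :=
    snd_pos_of_mem_timeScaleBox (one_pos.trans_le hN) (hbox hc)
  have hatom {c : ℝ × ℝ} (hc : c ∈ Icc (-N) N ×ˢ Icc 1 N) :=
    (integrable_waveletAtom (a := (c.1, σ c.2)) hψ.integrable (hpos hc)).aestronglyMeasurable
  have hdist : dist (a.1, σ a.2) (b.1, σ b.2) ≤ dist a b :=
    max_le_max_left _ ((hσ_lip.dist_le_mul _ ha.2.1 _ hb.2.1).trans_eq (by simp))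
  rw [← integral_sub (hψ.integrable_mul_conj_waveletAtom hx hx_int (hpos ha))
    (hψ.integrable_mul_conj_waveletAtom hx hx_int (hpos hb))]
  simp_rw [← mul_sub, ← map_sub]
  refine (pow_le_pow_left' (enorm_integral_le_lintegral_enorm _) 2).trans ?_
  refine (sq_lintegral_enorm_mul_conj_le (3 / 2) hx ((hatom ha).sub (hatom hb))).trans ?_
  rw [mul_assoc]
  gcongr
  refine (hmodulus N hN _ (hbox ha) _ (hbox hb)).trans ?_
  gcongr

theorem integral_waveletAtom_eq_zero (hψ : IsAnalyticWavelet ψ) {a : ℝ × ℝ} (ha : 0 < a.2) :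
    ∫ τ, waveletAtom ψ a τ = 0 := by
  have h := fourierHat_waveletAtom ψ ha 0
  rw [mul_zero, hψ.analytic 0 le_rfl, mul_zero] at h
  simpa [fourierHat] using h

theorem awtIntegrand_eq_sub_const_add (ψ : ℝ → ℂ) (f : ℝ → ℝ) (m t s τ : ℝ) :
    awtIntegrand ψ f t s τ =
      ((f τ - m : ℝ) : ℂ) * (starRingEnd ℂ) (waveletAtom ψ (t, s) τ) +
        m * (starRingEnd ℂ) (waveletAtom ψ (t, s) τ) := by
  rw [awtIntegrand_eq_mul_conj_waveletAtom, ← add_mul, ← Complex.ofReal_add, sub_add_cancel]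

theorem integrable_awtIntegrand_of_sub_const (hψ : Integrable ψ) {f : ℝ → ℝ} {m t s : ℝ}
    (hs : 0 < s)
    (hf : Integrable fun τ => ((f τ - m : ℝ) : ℂ) * (starRingEnd ℂ) (waveletAtom ψ (t, s) τ)) :
    Integrable (awtIntegrand ψ f t s) := by
  rw [funext fun τ => awtIntegrand_eq_sub_const_add ψ f m t s τ]
  exact hf.add (((LinearIsometryEquiv.integrable_comp_iff Complex.conjLIE).2
    (integrable_waveletAtom hψ hs)).const_mul _)

theorem awt_eq_integral_sub_const (hψ : IsAnalyticWavelet ψ) {f : ℝ → ℝ} {m t s : ℝ} (hs : 0 < s)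
    (hf : Integrable fun τ => ((f τ - m : ℝ) : ℂ) * (starRingEnd ℂ) (waveletAtom ψ (t, s) τ)) :
    awt ψ f t s = ∫ τ, ((f τ - m : ℝ) : ℂ) * (starRingEnd ℂ) (waveletAtom ψ (t, s) τ) := by
  have hconj : Integrable fun τ => (starRingEnd ℂ) (waveletAtom ψ (t, s) τ) :=
    (LinearIsometryEquiv.integrable_comp_iff Complex.conjLIE).2
      (integrable_waveletAtom hψ.integrable hs)
  simp_rw [awt, awtIntegrand_eq_sub_const_add ψ f m]
  rw [integral_add hf (hconj.const_mul _), integral_const_mul, integral_conj,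
    integral_waveletAtom_eq_zero hψ hs, map_zero, mul_zero, add_zero]

end Paths

section WaveletTransform

variable {Ω : Type*} [MeasurableSpace Ω] {P : Measure Ω} {p : ℝ → ℝ} {ψ : ℝ → ℂ} {C : ℝ}

theorem IsWideSenseStationary.ae_lintegral_inv_weight_rpow_mul_sq_lt_top [SFinite P]
    {X : ℝ → Ω → ℂ} (h : IsWideSenseStationary P X p) {r : ℝ} (hr : 1 < r) :
    ∀ᵐ ω ∂P, ∫⁻ τ, (weight τ ^ r)⁻¹ * ‖X τ ω‖ₑ ^ 2 < ∞ := by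
  obtain ⟨B, hB⟩ := h.exists_isSecondOrder
  exact hB.ae_lintegral_mul_sq_lt_top (measurable_weight.pow_const r).inv
    (fun τ => ENNReal.inv_ne_top.2
      (ENNReal.rpow_pos (pos_iff_ne_zero.2 (weight_ne_zero τ)) (weight_ne_top τ)).ne')
    (lintegral_inv_weight_rpow_lt_top hr)

theorem IsWideSenseStationary.ae_integrable_mul_conj_waveletAtom [SFinite P] {X : ℝ → Ω → ℂ}
    (hX : IsWideSenseStationary P X p) (hψ : IsRegularWavelet ψ C) :
    ∀ᵐ ω ∂P, ∀ a : ℝ × ℝ, 0 < a.2 →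
      Integrable fun τ => X τ ω * (starRingEnd ℂ) (waveletAtom ψ a τ) := by
  filter_upwards [hX.ae_lintegral_inv_weight_rpow_mul_sq_lt_top (r := 3 / 2) (by norm_num)]
    with ω hω a ha
  exact hψ.integrable_mul_conj_waveletAtom
    (hX.measurable.of_uncurry_right).aestronglyMeasurable hω ha

variable {Φ : ℝ → Ω → ℝ}

theorem ae_tendsto_integral_centered_mul_conj_waveletAtom
    (hΦ : IsGaussianProcess Φ P) (hX : IsWideSenseStationary P (centered P Φ) p)
    (hψ : IsRegularWavelet ψ C) {σ : ℝ → ℝ} (hσ : ∀ N, ∀ u ∈ Icc 1 N, σ u ∈ Icc N⁻¹ N)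
    (hσ_lip : LipschitzOnWith 1 σ (Ici 1)) {ε : ℝ} {B : ℝ≥0} (hε : 0 < ε)
    (hvar : ∀ u, 1 ≤ u → ∫⁻ x, ‖fourierHat ψ (σ u * x)‖ₑ ^ 2 ∂spectralMeasure p ≤
      B * ENNReal.ofReal (u ^ (-ε))) :
    ∀ᵐ ω ∂P, ∀ t, Tendsto (fun u => ∫ τ, centered P Φ τ ω *
      (starRingEnd ℂ) (waveletAtom ψ (t, σ u) τ)) atTop (𝓝 0) := by
  have := hΦ.isProbabilityMeasure
  obtain ⟨V, hV⟩ := hX.exists_isSecondOrder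
  have hatom {a : ℝ × ℝ} (ha : 1 ≤ a.2) : Integrable (waveletAtom ψ (a.1, σ a.2)) :=
    integrable_waveletAtom hψ.integrable
      ((inv_pos.2 (one_pos.trans_le ha)).trans_le (hσ a.2 a.2 ⟨ha, le_rfl⟩).1)
  refine ae_tendsto_zero_of_hasPolynomialModulus (β := 1 / 8) (κ := 3) hε (by norm_num)
    (Y := fun a ω => ∫ τ, centered P Φ τ ω * (starRingEnd ℂ) (waveletAtom ψ (a.1, σ a.2) τ))
    (fun a ha => ?_) (fun k hk => ?_) ?_
  · exact (hV.memLp_integral_mul ((LinearIsometryEquiv.integrable_comp_iff Complex.conjLIE).2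
      (hatom ha))).1.enorm
  · refine ⟨(2 * gaussianMomentConst (2 * k : ℕ)) ^ (2 * k) * B ^ k, ?_, fun a ha => ?_⟩
    · have := gaussianMomentConst_ne_top (q := (2 * k : ℕ)) (ENNReal.natCast_ne_top _)
      finiteness
    · refine (lintegral_pow_integral_centered_mul_conj_le hΦ hX (hatom ha) hk).trans ?_
      rw [lintegral_fourierHat_waveletAtom_sq hψ.integrable hX.integrable
        ((inv_pos.2 (one_pos.trans_le ha)).trans_le (hσ a.2 a.2 ⟨ha, le_rfl⟩).1), mul_assoc,
        ← mul_pow]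
      gcongr
      exact hvar a.2 ha
  · filter_upwards [hX.ae_lintegral_inv_weight_rpow_mul_sq_lt_top (r := 3 / 2) (by norm_num)]
      with ω hω
    exact hψ.hasPolynomialModulus_integral_mul_conj
      (hX.measurable.of_uncurry_right).aestronglyMeasurable hω hσ hσ_lip

theorem ae_integrable_awtIntegrand [SFinite P] (hstat : IsStationaryProcess P Φ)
    (hX : IsWideSenseStationary P (centered P Φ) p) (hψ : IsRegularWavelet ψ C) :
    ∀ᵐ ω ∂P, ∀ t s : ℝ, 0 < s → Integrable (awtIntegrand ψ (fun τ => Φ τ ω) t s) := by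
  filter_upwards [hX.ae_integrable_mul_conj_waveletAtom hψ] with ω hω t s hs
  refine integrable_awtIntegrand_of_sub_const hψ.integrable hs (m := ∫ ω', Φ 0 ω' ∂P) ?_
  simpa only [hstat.centered_eq] using hω (t, s) hs

theorem ae_tendsto_awt (hΦ : IsGaussianProcess Φ P) (hstat : IsStationaryProcess P Φ)
    (hX : IsWideSenseStationary P (centered P Φ) p) (hψ : IsAnalyticWavelet ψ)
    (hψ_reg : IsRegularWavelet ψ C) {σ : ℝ → ℝ} (hσ : ∀ N, ∀ u ∈ Icc 1 N, σ u ∈ Icc N⁻¹ N)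
    (hσ_lip : LipschitzOnWith 1 σ (Ici 1)) {ε : ℝ} {B : ℝ≥0} (hε : 0 < ε)
    (hvar : ∀ u, 1 ≤ u → ∫⁻ x, ‖fourierHat ψ (σ u * x)‖ₑ ^ 2 ∂spectralMeasure p ≤
      B * ENNReal.ofReal (u ^ (-ε))) :
    ∀ᵐ ω ∂P, ∀ t, Tendsto (fun u => awt ψ (fun τ => Φ τ ω) t (σ u)) atTop (𝓝 0) := by
  have := hΦ.isProbabilityMeasure
  filter_upwards [hX.ae_integrable_mul_conj_waveletAtom hψ_reg,
    ae_tendsto_integral_centered_mul_conj_waveletAtom hΦ hX hψ_reg hσ hσ_lip hε hvar]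
    with ω h_integrable h_tendsto t
  refine (h_tendsto t).congr' ?_
  filter_upwards [eventually_ge_atTop 1] with u hu
  have hσu : 0 < σ u := (inv_pos.2 (one_pos.trans_le hu)).trans_le (hσ u u ⟨hu, le_rfl⟩).1
  have h := h_integrable (t, σ u) hσu
  simp only [hstat.centered_eq] at h ⊢
  exact (awt_eq_integral_sub_const hψ hσu h).symm

theorem inv_mem_Icc_inv {N u : ℝ} (hu : u ∈ Icc 1 N) : u⁻¹ ∈ Icc N⁻¹ N :=
  ⟨inv_anti₀ (one_pos.trans_le hu.1) hu.2,
    (inv_le_one_of_one_le₀ hu.1).trans (hu.1.trans hu.2)⟩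

theorem lipschitzOnWith_inv_Ici_one : LipschitzOnWith 1 (fun u : ℝ => u⁻¹) (Ici 1) := by
  refine LipschitzOnWith.of_dist_le_mul fun u (hu : 1 ≤ u) v (hv : 1 ≤ v) => ?_
  rw [dist_inv_inv₀ (by positivity) (by positivity), NNReal.coe_one, one_mul]
  refine div_le_self dist_nonneg (one_le_mul_of_one_le_of_one_le ?_ ?_)
  all_goals rwa [Real.norm_of_nonneg (by positivity)]

end WaveletTransform

end WaveletNoise

open WaveletNoise in
theorem mainTheorem11_general {Ω : Type*} [MeasurableSpace Ω] {P : Measure Ω} {Φ : ℝ → Ω → ℝ}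
    {p : ℝ → ℝ} {ψ : ℝ → ℂ} (hmeas : Measurable (Function.uncurry Φ)) (hΦ : IsGaussianProcess Φ P)
    (hstat : IsStationaryProcess P Φ) (hp : IsSpectralDensity P Φ p) (hψ : IsAnalyticWavelet ψ)
    (hreg : WaveletRegularity ψ) :
    (∀ᵐ ω ∂P, ∀ t s : ℝ, 0 < s → Integrable (awtIntegrand ψ (fun τ => Φ τ ω) t s)) ∧
    (HighFrequencyDecay (spectralMeasure p) → ∀ᵐ ω ∂P, ∀ t,
      Tendsto (fun s => awt ψ (fun τ => Φ τ ω) t s) (𝓝[>] 0) (𝓝 0)) ∧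
    (LowFrequencyDecay (spectralMeasure p) → ∀ᵐ ω ∂P, ∀ t,
      Tendsto (fun s => awt ψ (fun τ => Φ τ ω) t s) atTop (𝓝 0)) := by
  have := hΦ.isProbabilityMeasure
  have := isFiniteMeasure_spectralMeasure hp.integrable
  obtain ⟨C, hC⟩ := hψ.exists_isRegularWavelet hreg
  have hX := isWideSenseStationary_centered hmeas (fun t => (hΦ.hasGaussianLaw_eval t).memLp_two)
    hstat hp
  refine ⟨ae_integrable_awtIntegrand hstat hX hC, fun h_high => ?_, fun h_low => ?_⟩
  · obtain ⟨ε, B, hε, hvar⟩ := hC.exists_lintegral_contract_sq_le h_high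
    filter_upwards [ae_tendsto_awt hΦ hstat hX hψ hC (fun _ _ => inv_mem_Icc_inv)
      lipschitzOnWith_inv_Ici_one hε hvar] with ω hω t
    simpa only [Function.comp_def, inv_inv] using (hω t).comp tendsto_inv_nhdsGT_zero
  · obtain ⟨ε, B, hε, hvar⟩ := hC.exists_lintegral_dilate_sq_le h_low
    exact ae_tendsto_awt hΦ hstat hX hψ hC
      (fun _ _ hu => ⟨(inv_le_one_of_one_le₀ (hu.1.trans hu.2)).trans hu.1, hu.2⟩)
      LipschitzWith.id.lipschitzOnWith hε hvar

theorem mainTheorem11 {Ω : Type*} [MeasurableSpace Ω] (P : Measure Ω) [IsProbabilityMeasure P]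
    (Φ : ℝ → Ω → ℝ) (p : ℝ → ℝ) (hΦ : WaveletNoise.IsGaussianNoise P Φ p)
    (ψ : ℝ → ℂ) (hψ : WaveletNoise.IsAnalyticWavelet ψ)
    (hreg : WaveletNoise.WaveletRegularity ψ) :
    (∀ᵐ ω ∂P, ∀ t s : ℝ, 0 < s →
      Integrable (WaveletNoise.awtIntegrand ψ (fun τ => Φ τ ω) t s)) ∧
    (WaveletNoise.SpectralDecay p →
      ∀ᵐ ω ∂P, ∀ t : ℝ,
        Tendsto (fun s : ℝ => WaveletNoise.awt ψ (fun τ => Φ τ ω) t s) (𝓝[>] 0) (𝓝 0)) ∧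
    (WaveletNoise.LongRangeDependence p ∨ WaveletNoise.ShortRangeDependence p →
      ∀ᵐ ω ∂P, ∀ t : ℝ,
        Tendsto (fun s : ℝ => WaveletNoise.awt ψ (fun τ => Φ τ ω) t s) atTop (𝓝 0)) := by
  obtain ⟨h_integrable, h_high, h_low⟩ :=
    mainTheorem11_general hΦ.measurable hΦ.gaussian hΦ.stationary hΦ.spectralDensity hψ hreg
  exact ⟨h_integrable, fun hp => h_high hp.highFrequencyDecay, fun hp => h_low
    (hp.elim (·.lowFrequencyDecay hΦ.spectralDensity.integrable) (·.lowFrequencyDecay))⟩
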